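/- Let $\mathcal V$ be a Euclidean Jordan algebra, i.e. a finite-dimensional real vector space with a commutative bilinear product $\circ$ with unit $e$, satisfying $(x\circ y)\circ x^2=x\circ(y\circ x^2)$ and admitting an inner product for which all the maps $L_a(x)=a\circ x$ are self-adjoint. Let $n$ be its rank, and let $\lambda(x)=(\lambda_1(x)\ge\dots\ge\lambda_n(x))$ be the vector of eigenvalues of $x$, so that $x=\sum_{i=1}^n\lambda_i(x)e_i$ for some Jordan frame $(e_1,\dots,e_n)$, that is, primitive idempotents with $e_i\circ e_j=0$ for $i\ne j$ and $e_1+\dots+e_n=e$. Put $\operatorname{tr}(x)=\sum_{i=1}^n\lambda_i(x)$ and equip $\mathcal V$ with the inner product $\langle x,y\rangle=\operatorname{tr}(x\circ y)$. Elements $a,b\in\mathcal V$ operator commute if $L_aL_b=L_bL_a$; they strongly operator commute if there is one Jordan frame $(e_1,\dots,e_n)$ with $a=\sum_i\lambda_i(a)e_i$ and $b=\sum_i\lambda_i(b)e_i$. A function $F:\mathcal V\to(-\infty,\infty]$ is spectral if $F=f\circ\lambda$ for a permutation invariant $f:\mathbb R^n\to(-\infty,\infty]$, and weakly spectral if $F(Ax)=F(x)$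 for all $x\in\mathcal V$ and all algebra automorphisms $A$ of $\mathcal V$ (invertible linear maps preserving $\circ$). $\mathcal V$ is simple if it is nonzero and not the direct product of two nonzero Euclidean Jordan algebras; it is essentially simple if it is simple or isomorphic to some $\mathbb R^m$ with the componentwise product. Let $F:\mathcal V\to(-\infty,\infty]$ (in particular, $F$ may be real-valued), let $a\in\mathcal V$ with $F(a)<\infty$, and let $d\in\partial F(a)$, that is, $F(x)-F(a)\ge\langle d,x-a\rangle$ for all $x\in\mathcal V$. Then: (a) if $F$ is spectral, then $d$ and $a$ strongly operator commute; (b) if $F$ is weakly spectral, then $d$ and $a$ operator commute. Moreover, if $\mathcal V$ is essentially simple and $F$ is weakly spectral, then $d$ and $a$ strongly operator commute. -/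

import Mathlib

namespace EJA

/-- `V`, a finite-dimensional real vector space with a commutative bilinear product `x * y`
(the Jordan product `x ∘ y`) and a unit `1`, is a Euclidean Jordan algebra: the Jordan identity
holds and there is an inner product (a symmetric positive definite bilinear form) for which
every multiplication operator is self-adjoint. -/
class EuclideanJordanAlgebra (V : Type*) [NonAssocCommRing V] [Module ℝ V]
    [IsScalarTower ℝ V V] [SMulCommClass ℝ V V] : Prop where
  finiteDimensional : FiniteDimensional ℝ V
  jordan : IsCommJordan V
  exists_inner : ∃ B : V →ₗ[ℝ] V →ₗ[ℝ] ℝ,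
    (∀ x y, B x y = B y x) ∧ (∀ x, x ≠ 0 → 0 < B x x) ∧
      ∀ x y z, B (x * y) z = B y (x * z)

section Defs

variable {V : Type*} [NonAssocCommRing V] [Module ℝ V]

/-- Powers `x ^ 0 = 1`, `x ^ (k + 1) = x ∘ x ^ k` in the Jordan algebra. -/
def jpow (x : V) : ℕ → V
  | 0 => 1
  | k + 1 => x * jpow x k

/-- The degree of the minimal polynomial of `x`, i.e. the dimension of the subalgebra
`ℝ[x] = span {1, x, x ^ 2, …}`. -/
noncomputable def degree (x : V) : ℕ :=
  Module.finrank ℝ (Submodule.span ℝ (Set.range (jpow x)))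

variable (V) in
/-- The rank of `V`: the largest degree of an element (the set of degrees is bounded by the
dimension of `V`). -/
noncomputable def rank : ℕ := ⨆ x : V, degree x

/-- A nonzero idempotent that is not the sum of two nonzero idempotents. -/
def IsPrimitive (c : V) : Prop :=
  c ≠ 0 ∧ c * c = c ∧ ¬ ∃ p q : V, p ≠ 0 ∧ q ≠ 0 ∧ p * p = p ∧ q * q = q ∧ c = p + q

/-- An ordered Jordan frame `(e₁, …, eₙ)`, where `n` is the rank of `V`. -/
def IsJordanFrame (e : Fin (rank V) → V) : Prop :=
  (∀ i, IsPrimitive (e i)) ∧ (∀ i j, i ≠ j → e i * e j = 0) ∧ ∑ i, e i = 1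

/-- `μ₁ ≥ ⋯ ≥ μₙ` and `x = μ₁ e₁ + ⋯ + μₙ eₙ` for some Jordan frame. -/
def IsEigenvalueVector (x : V) (μ : Fin (rank V) → ℝ) : Prop :=
  Antitone μ ∧ ∃ e : Fin (rank V) → V, IsJordanFrame e ∧ x = ∑ i, μ i • e i

/-- The eigenvalue map `λ : V → ℝⁿ`: the vector of eigenvalues of `x` in decreasing order,
which by the spectral theorem exists and is unique in a Euclidean Jordan algebra. -/
noncomputable def eigenvalues (x : V) : Fin (rank V) → ℝ :=
  Classical.epsilon (IsEigenvalueVector x)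

/-- The trace of `x`, the sum of its eigenvalues. -/
noncomputable def tr (x : V) : ℝ := ∑ i, eigenvalues x i

/-- The trace inner product `⟨x, y⟩ = tr (x ∘ y)`. -/
noncomputable def ip (x y : V) : ℝ := tr (x * y)

/-- `L_a L_b = L_b L_a`. -/
def OperatorCommute (a b : V) : Prop := ∀ x : V, a * (b * x) = b * (a * x)

/-- `a = ∑ λᵢ(a) eᵢ` and `b = ∑ λᵢ(b) eᵢ` for a common (ordered) Jordan frame. -/
def StronglyOperatorCommute (a b : V) : Prop :=
  ∃ e : Fin (rank V) → V, IsJordanFrame e ∧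
    a = ∑ i, eigenvalues a i • e i ∧ b = ∑ i, eigenvalues b i • e i

/-- Algebra automorphisms: invertible linear maps that preserve the Jordan product. -/
def IsAutomorphism (A : V ≃ₗ[ℝ] V) : Prop := ∀ x y, A (x * y) = A x * A y

/-- `F = f ∘ λ` for a permutation invariant `f : ℝⁿ → (-∞, ∞]`. -/
def IsSpectral (F : V → WithTop ℝ) : Prop :=
  ∃ f : (Fin (rank V) → ℝ) → WithTop ℝ,
    (∀ (σ : Equiv.Perm (Fin (rank V))) (u : Fin (rank V) → ℝ), f (u ∘ σ) = f u) ∧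
      ∀ x, F x = f (eigenvalues x)

/-- `F (A x) = F x` for all algebra automorphisms `A`. -/
def IsWeaklySpectral (F : V → WithTop ℝ) : Prop :=
  ∀ A : V ≃ₗ[ℝ] V, IsAutomorphism A → ∀ x, F (A x) = F x

/-- The subdifferential `∂F(a)` of `F : V → (-∞, ∞]` at a point `a` of its domain
`{x | F x < ∞}` (empty if `a` is not in the domain): all `d` with
`F x - F a ≥ ⟨d, x - a⟩` for all `x`. -/
def subdifferential (F : V → WithTop ℝ) (a : V) : Set V :=
  {d | F a ≠ ⊤ ∧ ∀ x, F a + ((ip d (x - a) : ℝ) : WithTop ℝ) ≤ F x}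

/-- Ideals of the (commutative) algebra `V`. -/
def IsIdeal (I : Submodule ℝ V) : Prop := ∀ x ∈ I, ∀ y : V, y * x ∈ I

variable (V) in
/-- `V` is nonzero and is not the (internal) direct product of two nonzero algebras: whenever
`V = I ⊕ J` with ideals `I`, `J`, one of them is zero. -/
def IsSimple : Prop :=
  Nontrivial V ∧ ∀ I J : Submodule ℝ V, IsIdeal I → IsIdeal J → IsCompl I J → I = ⊥ ∨ J = ⊥

variable (V) in
/-- `V` is simple or isomorphic to some `ℝᵐ` with the componentwise product. -/
def IsEssentiallySimple : Prop :=
  IsSimple V ∨ ∃ (m : ℕ) (φ : V ≃ₗ[ℝ] (Fin m → ℝ)), ∀ x y, φ (x * y) = φ x * φ y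

end Defs

end EJA

/-! An automorphism `A` leaves `F` unchanged, so the subgradient inequality at `A a` says that `a`
maximizes `⟨d, ·⟩` over its automorphism orbit. Inner derivations `[L_u, L_v]` generate
one-parameter groups of automorphisms. The first derivative along them vanishes at `a`, and by
associativity of the trace form this forces `[L_d, L_a] = 0` (`operatorCommute_of_max`).

Operator commuting elements share a Jordan frame, `a = ∑ μᵢ eᵢ` and `d = ∑ νᵢ eᵢ`
(`exists_common_system`). For strong commutation it then suffices that `(μᵢ - μⱼ)(νᵢ - νⱼ) ≥ 0` for
all pairs, since one reordering of the frame sorts both vectors. For spectral `F` the inequality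
comes from swapping two coefficients of `a`, which keeps its eigenvalues; in `ℝᵐ` an automorphism
performs the swap. In a simple algebra any two members of a frame have a nonzero joint Peirce space
(`linked_of_isSimple`), and the second-order condition along `[L_{eᵢ}, L_w]`, with `w` in that
space, gives the inequality (`nonneg_of_linked`).

All this rests on a linear functional equal to `1` at every primitive idempotent (`exists_trace`):
it fixes the size of frames, makes eigenvalues unique and makes `tr` linear. -/

set_option linter.unusedSectionVars false

namespace EJA

attribute [instance] EuclideanJordanAlgebra.finiteDimensional EuclideanJordanAlgebra.jordan

/-! ### Peirce decomposition relative to an idempotent -/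

section Peirce

variable {V : Type*} [NonAssocCommRing V] [Module ℝ V] [IsScalarTower ℝ V V]
  [SMulCommClass ℝ V V] [EuclideanJordanAlgebra V]

/-- The full linearization of the Jordan identity. -/
theorem polarized_jordan (a b c x : V) :
    a * ((b * c) * x) + b * ((c * a) * x) + c * ((a * b) * x) =
      (b * c) * (a * x) + (c * a) * (b * x) + (a * b) * (c * x) := by
  have h : 2 • ((a * ((b * c) * x) - (b * c) * (a * x)) + (b * ((c * a) * x) - (c * a) * (b * x))
      + (c * ((a * b) * x) - (a * b) * (c * x))) = 0 :=
    DFunLike.congr_fun (two_nsmul_lie_lmul_lmul_add_add_eq_zero a b c) x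
  linear_combination (norm := module) (1 / 2 : ℝ) • h

variable {c : V}

/-- As `2t³ - 3t² + t = t(2t - 1)(t - 1)`, the only possible eigenvalues of `L_c` are `0`, `1/2` and
`1`. -/
theorem peirce_cubic (hc : c * c = c) (x : V) :
    (2 : ℝ) • (c * (c * (c * x))) + c * x = (3 : ℝ) • (c * (c * x)) := by
  have h := polarized_jordan c c x c
  simp only [hc, mul_comm _ c] at h
  linear_combination (norm := module) h

/-- The linearized identity reads `(2i - 1) c(uv) = (2i - 1) j uv`, and the factor cancels. With `i
= 0, 1` this gives every Peirce product rule except half times half. -/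
theorem peirce_mul (hc : c * c = c) {u v : V} {i j : ℝ} (hi : i ≠ 1 / 2) (hu : c * u = i • u)
    (hv : c * v = j • v) : c * (u * v) = j • (u * v) := by
  have h := polarized_jordan c c u v
  simp only [hc, mul_comm u c, hu, hv, smul_mul_assoc, mul_smul_comm] at h
  have h2 : (2 * i - 1) • (c * (u * v)) = (2 * i - 1) • (j • (u * v)) := by
    linear_combination (norm := module) h
  exact (smul_right_inj (by contrapose! hi; linarith)).1 h2

theorem peirce_half_mul_half (hc : c * c = c) {u v : V} (hu : c * u = (1 / 2 : ℝ) • u)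
    (hv : c * v = (1 / 2 : ℝ) • v) : c * (c * (u * v)) = c * (u * v) := by
  have h := polarized_jordan u v c c
  simp only [hc, mul_comm _ c, hu, hv, smul_mul_assoc, mul_smul_comm] at h
  rw [mul_comm v u] at h
  linear_combination (norm := module) h

/-- The Peirce one component `2 c (c x) - c x` of `x`. -/
theorem peirce_one_component (hc : c * c = c) (x : V) :
    c * ((2 : ℝ) • (c * (c * x)) - c * x) = (2 : ℝ) • (c * (c * x)) - c * x := by
  have h := peirce_cubic hc x
  simp only [mul_sub, mul_smul_comm]
  linear_combination (norm := module) h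

/-- Lagrange interpolation at `0, 1/2, 1` gives the Peirce projections `1 - 3L + 2L²`, `4(L - L²)`
and `2L² - L` of `L = L_c`; the factor `4` is dropped here. -/
theorem peirce_half_component (hc : c * c = c) (x : V) :
    c * (c * x - c * (c * x)) = (1 / 2 : ℝ) • (c * x - c * (c * x)) := by
  have h := peirce_cubic hc x
  simp only [mul_sub]
  linear_combination (norm := module) (-1 / 2 : ℝ) • h

theorem peirce_zero_component (hc : c * c = c) (x : V) :
    c * (x - (3 : ℝ) • (c * x) + (2 : ℝ) • (c * (c * x))) = 0 := by
  have h := peirce_cubic hc x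
  simp only [mul_sub, mul_add, mul_smul_comm]
  linear_combination (norm := module) h

/-- Elements without Peirce one-half component relative to `c` operator commute with `c`. -/
theorem peirce_commute (hc : c * c = c) {u : V} (hu : c * (c * u) = c * u) (v : V) :
    c * (u * v) = u * (c * v) := by
  -- `h'` gives `c((cu)v) = (cu)(cv)`; inserted in `h`, it leaves `u(cv) = c(uv)`.
  have h := polarized_jordan c c u v
  have h' := polarized_jordan c c (c * u) v
  simp only [hc, mul_comm u c, mul_comm (c * u) c, hu] at h h'
  linear_combination (norm := module) (2 : ℝ) • h' - h

/-- By `peirce_mul` used from both sides, `uv` is an eigenvector of `L_c` for `0` and for `1` at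
once. -/
theorem peirce_one_mul_zero (hc : c * c = c) {u v : V} (hu : c * u = u) (hv : c * v = 0) :
    u * v = 0 := by
  have h1 := peirce_mul hc (i := 1) (j := 0) (u := u) (v := v) (by norm_num) (by simpa) (by simpa)
  have h2 := peirce_mul hc (i := 0) (j := 1) (u := v) (v := u) (by norm_num) (by simpa) (by simpa)
  rw [mul_comm v u, h1] at h2
  simpa using h2.symm

/-- Products of elements without Peirce one-half component relative to `c`. -/
theorem peirce_component_mul (hc : c * c = c) {u v : V} (hu : c * (c * u) = c * u)
    (hv : c * (c * v) = c * v) : (c * u) * (c * v) = c * (u * v) := by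
  rw [peirce_commute hc hu v, ← sub_eq_zero, ← sub_mul, ← neg_eq_zero, ← neg_mul, neg_sub,
    mul_comm]
  exact peirce_one_mul_zero hc hv (by rw [mul_sub, hu, sub_self])

theorem peirce_mul_mem (hc : c * c = c) {u v : V} (hu : c * (c * u) = c * u)
    (hv : c * (c * v) = c * v) : c * (c * (u * v)) = c * (u * v) := by
  rw [peirce_commute hc hu v, peirce_commute hc hu, hv]

theorem orthogonal_commute (hc : c * c = c) {d : V} (h : c * d = 0) (x : V) :
    c * (d * x) = d * (c * x) :=
  peirce_commute hc (by rw [h, mul_zero]) x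

/-- The Peirce one component of `x` is killed by `d`, which lies in the zero space of `c`; commuting
`L_d` past `L_c` turns this into the claim. -/
theorem orthogonal_mul_half (hc : c * c = c) {d : V} (h : c * d = 0) (x : V) :
    c * (c * (d * x)) = (1 / 2 : ℝ) • (c * (d * x)) := by
  have h1 := peirce_one_mul_zero hc (peirce_one_component hc x) h
  rw [mul_comm, mul_sub, mul_smul_comm] at h1
  rw [orthogonal_commute hc h, orthogonal_commute hc h]
  linear_combination (norm := module) (1 / 2 : ℝ) • h1

theorem orthogonal_mul_mul (hc : c * c = c) {d : V} (hd : d * d = d) (h : c * d = 0) (x : V) :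
    c * (d * (c * (d * x))) = (1 / 4 : ℝ) • (c * (d * x)) := by
  have h' : d * c = 0 := by rw [mul_comm, h]
  rw [← orthogonal_commute hc h (d * x), orthogonal_mul_half hc h, orthogonal_commute hc h,
    orthogonal_commute hc h, orthogonal_mul_half hd h']
  module

/-- `P(c) P(y) c = (P(c) y)²` for an idempotent `c`, where `P` is the quadratic representation. -/
theorem quadratic_idempotent (hc : c * c = c) (y : V) :
    let z := (2 : ℝ) • (y * (y * c)) - (y * y) * c
    (2 : ℝ) • (c * (c * z)) - c * z =
      ((2 : ℝ) • (c * (c * y)) - c * y) * ((2 : ℝ) • (c * (c * y)) - c * y) := by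
  intro z
  -- `p`, `q`, `r` are the Peirce components of `y` for `1`, `1/2`, `0`; after expansion by the
  -- product rules only `p * p` survives.
  obtain ⟨p, hp⟩ : ∃ p, p = (2 : ℝ) • (c * (c * y)) - c * y := ⟨_, rfl⟩
  obtain ⟨q, hq⟩ : ∃ q, q = (4 : ℝ) • (c * y - c * (c * y)) := ⟨_, rfl⟩
  obtain ⟨r, hr⟩ : ∃ r, r = y - (3 : ℝ) • (c * y) + (2 : ℝ) • (c * (c * y)) := ⟨_, rfl⟩
  have hcp : c * p = p := hp ▸ peirce_one_component hc y
  have hcq : c * q = (1 / 2 : ℝ) • q := by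
    rw [hq, mul_smul_comm, peirce_half_component hc y]; module
  have hcr : c * r = 0 := hr ▸ peirce_zero_component hc y
  have hy : y = p + q + r := by rw [hp, hq, hr]; module
  rw [← hp]
  have hpr := peirce_one_mul_zero hc hcp hcr
  have hpp := peirce_mul hc (i := 1) (j := 1) (u := p) (v := p) (by norm_num) (by simpa) (by simpa)
  have hrr := peirce_mul hc (i := 0) (j := 0) (u := r) (v := r) (by norm_num) (by simpa) (by simpa)
  have hpq := peirce_mul hc (i := 1) (u := p) (v := q) (by norm_num) (by simpa) hcq
  have hrq := peirce_mul hc (i := 0) (u := r) (v := q) (by norm_num) (by simpa) hcq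
  have hqq := peirce_half_mul_half hc hcq hcq
  rw [one_smul] at hpp
  rw [zero_smul] at hrr
  have hyc : y * c = p + (1 / 2 : ℝ) • q := by
    rw [mul_comm, hy, mul_add, mul_add, hcp, hcq, hcr, add_zero]
  have hz : z = (2 : ℝ) • (y * (y * c)) - c * (y * y) := by rw [mul_comm c]
  rw [hz, hyc, hy]
  simp only [mul_add, add_mul, mul_smul_comm, mul_sub, hpr, hpp, hrr, hpq, hrq,
    hqq, mul_comm r p, mul_comm q p, mul_comm q r, mul_zero]
  module

end Peirce
-- Power associativity and the spectral theorem
section Spectral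

open Polynomial

/-- A self-adjoint operator has a basis of eigenvectors, and the product over its distinct
eigenvalues kills each of them. Distinct roots are what Lagrange interpolation needs later. -/
theorem exists_aeval_prod_eq_zero {E : Type*} [AddCommGroup E] [Module ℝ E]
    [FiniteDimensional ℝ E] (B : E →ₗ[ℝ] E →ₗ[ℝ] ℝ) (hs : ∀ x y, B x y = B y x)
    (hp : ∀ x, x ≠ 0 → 0 < B x x) (L : Module.End ℝ E) (hL : ∀ x y, B (L x) y = B x (L y)) :
    ∃ s : Finset ℝ, aeval L (∏ α ∈ s, (X - C α)) = 0 := by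
  let core : InnerProductSpace.Core ℝ E :=
    { inner := fun x y => B x y
      conj_inner_symm := fun x y => by simpa using hs y x
      re_inner_nonneg := fun x => by
        rcases eq_or_ne x 0 with rfl | hx
        · simp
        · simpa using (hp x hx).le
      add_left := fun x y z => by simp
      smul_left := fun x y r => by simp
      definite := fun x hx => by
        by_contra h
        exact (hp x h).ne' hx }
  let _ : NormedAddCommGroup E := core.toNormedAddCommGroup
  let _ : InnerProductSpace ℝ E := InnerProductSpace.ofCore core.toCore
  have hsym : LinearMap.IsSymmetric L := fun x y => hL x y
  let b := hsym.eigenvectorBasis rfl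
  refine ⟨Finset.univ.image (hsym.eigenvalues rfl), b.toBasis.ext fun i => ?_⟩
  have hi : L (b i) = hsym.eigenvalues rfl i • b i := hsym.apply_eigenvectorBasis rfl i
  obtain ⟨q, hq⟩ : X - C (hsym.eigenvalues rfl i) ∣
      ∏ α ∈ Finset.univ.image (hsym.eigenvalues rfl), (X - C α) :=
    Finset.dvd_prod_of_mem _ (Finset.mem_image_of_mem _ (Finset.mem_univ i))
  rw [hq, mul_comm, OrthonormalBasis.coe_toBasis, map_mul]
  simp [hi, Module.End.mul_apply, Algebra.algebraMap_eq_smul_one]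

variable {V : Type*} [NonAssocCommRing V] [Module ℝ V] [IsScalarTower ℝ V V]
  [SMulCommClass ℝ V V] [EuclideanJordanAlgebra V]

local notation "mulL" => LinearMap.mulLeft ℝ

/-- With `y` a power of `x`, this recursion expresses multiplication by higher powers through `L_x`
and `L_{x²}`. -/
theorem mulLeft_sq_mul (x y : V) :
    mulL (x * x * y) = mulL (x * x) * mulL y + (2 : ℝ) • ((mulL (x * y) - mulL x * mulL y) * mulL x)
    := by
  ext z
  have h := polarized_jordan x x z y
  simp only [LinearMap.mulLeft_apply, LinearMap.add_apply, LinearMap.smul_apply,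
    Module.End.mul_apply, LinearMap.sub_apply]
  rw [mul_comm z x, mul_comm z (x * x * y)] at h
  rw [mul_comm y (x * z), mul_comm (x * y) (x * z), mul_comm y z]
  linear_combination (norm := module) h

theorem commute_mulLeft_sq (x : V) : Commute (mulL x) (mulL (x * x)) := by
  ext z
  have h := polarized_jordan x x x z
  simp only [LinearMap.mulLeft_apply, Module.End.mul_apply]
  linear_combination (norm := module) (1 / 3 : ℝ) • h

/-- Both commutations are carried through the induction because the recursion for `L_{xⁿ⁺²}`
involves both `L_x` and `L_{x²}`. -/
theorem commute_mulLeft_jpow (x : V) (n : ℕ) :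
    Commute (mulL (jpow x n)) (mulL x) ∧ Commute (mulL (jpow x n)) (mulL (x * x)) := by
  induction n using Nat.strong_induction_on with
  | _ n ih =>
    match n with
    | 0 => exact ⟨by ext; simp [jpow], by ext; simp [jpow]⟩
    | 1 => simpa [jpow] using commute_mulLeft_sq x
    | n + 2 =>
      have h0 := ih n (by omega)
      have h1 := ih (n + 1) (by omega)
      have hx := commute_mulLeft_sq x
      have h : jpow x (n + 2) = x * x * jpow x n := by
        have := LinearMap.congr_fun h0.1 x
        simp only [LinearMap.mulLeft_apply, Module.End.mul_apply] at this
        rw [jpow, jpow, mul_comm (x * x), this, mul_comm x (jpow x n)]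
      rw [h, mulLeft_sq_mul]
      refine ⟨(hx.symm.mul_left h0.1).add_left (Commute.smul_left
        (((h1.1.sub_left ((Commute.refl _).mul_left h0.1))).mul_left (Commute.refl _)) _),
        ((Commute.refl _).mul_left h0.2).add_left (Commute.smul_left
        (((h1.2.sub_left (hx.mul_left h0.2))).mul_left hx) _)⟩

theorem mulLeft_pow_one (x : V) (n : ℕ) : (mulL x ^ n) 1 = jpow x n := by
  induction n with
  | zero => rfl
  | succ n ih => rw [pow_succ', Module.End.mul_apply, ih]; rfl

theorem commute_mulLeft_aeval (x : V) (p : ℝ[X]) :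
    Commute (mulL (aeval (mulL x) p 1)) (mulL x) := by
  induction p using Polynomial.induction_on' with
  | add p q hp hq =>
    have : mulL (aeval (mulL x) (p + q) 1) =
        mulL (aeval (mulL x) p 1) + mulL (aeval (mulL x) q (1 : V)) := by
      ext; simp [add_mul]
    rw [this]
    exact hp.add_left hq
  | monomial n a =>
    have : mulL (aeval (mulL x) (monomial n a) 1) = a • mulL (jpow x n) := by
      ext; simp [aeval_monomial, Module.End.mul_apply, mulLeft_pow_one, smul_mul_assoc]
    rw [this]
    exact (commute_mulLeft_jpow x n).1.smul_left a

/-- Power associativity: `L_{p(x)}` commutes with `L_x`, hence with `q(L_x)`; evaluate at `1`. -/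
theorem aeval_mul_aeval (x : V) (p q : ℝ[X]) :
    aeval (mulL x) p 1 * aeval (mulL x) q 1 = aeval (mulL x) (p * q) 1 := by
  have h : Commute (mulL (aeval (mulL x) p 1)) (aeval (mulL x) q) := by
    induction q using Polynomial.induction_on' with
    | add q r hq hr => rw [map_add]; exact hq.add_right hr
    | monomial n a =>
      rw [aeval_monomial]
      exact (Algebra.commute_algebraMap_right a _).mul_right ((commute_mulLeft_aeval x p).pow_right n)
  have h' := LinearMap.congr_fun h 1
  simp only [Module.End.mul_apply, LinearMap.mulLeft_apply, mul_one] at h'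
  rw [h', mul_comm p, map_mul, Module.End.mul_apply]

theorem aeval_eigenvector {E : Type*} [AddCommGroup E] [Module ℝ E] (L : Module.End ℝ E) {v : E}
    {α : ℝ} (h : L v = α • v) (p : ℝ[X]) : aeval L p v = p.eval α • v := by
  induction p using Polynomial.induction_on' with
  | add p q hp hq => simp [hp, hq, add_smul]
  | monomial n a =>
    have : (L ^ n) v = α ^ n • v := by
      induction n with
      | zero => simp
      | succ n ih => rw [pow_succ', Module.End.mul_apply, ih, map_smul, h, smul_smul, pow_succ]
    simp [aeval_monomial, Module.End.mul_apply, this, smul_smul, mul_comm]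

theorem aeval_mem {E : Type*} [AddCommGroup E] [Module ℝ E] (L : Module.End ℝ E) {v : E}
    (S : Submodule ℝ E) (hv : v ∈ S) (hL : ∀ y ∈ S, L y ∈ S) (p : ℝ[X]) : aeval L p v ∈ S := by
  induction p using Polynomial.induction_on' with
  | add p q hp hq => rw [map_add]; exact S.add_mem hp hq
  | monomial n a =>
    have : (L ^ n) v ∈ S := by
      induction n with
      | zero => simpa
      | succ n ih => rw [pow_succ', Module.End.mul_apply]; exact hL _ ih
    simpa [aeval_monomial, Module.End.mul_apply] using S.smul_mem a this

/-- The spectral theorem: `x = ∑ α uₐ` for orthogonal idempotents `uₐ` with sum `1`, which belong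
to every subspace that contains `1` and is invariant under multiplication by `x`. -/
theorem exists_spectral_decomposition (x : V) : ∃ (s : Finset ℝ) (u : ℝ → V),
    (∀ α ∈ s, u α * u α = u α) ∧ (∀ α ∈ s, ∀ β ∈ s, α ≠ β → u α * u β = 0) ∧
    ∑ α ∈ s, u α = 1 ∧ x = ∑ α ∈ s, α • u α ∧ (∀ α ∈ s, x * u α = α • u α) ∧
    ∀ α, ∀ S : Submodule ℝ V, 1 ∈ S → (∀ y ∈ S, x * y ∈ S) → u α ∈ S := by
  obtain ⟨B, hs, hp, ha⟩ := EuclideanJordanAlgebra.exists_inner (V := V)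
  obtain ⟨s, hsx⟩ := exists_aeval_prod_eq_zero B hs hp (mulL x) fun y z => ha x y z
  -- `(X - α) ℓ_α` is a constant multiple of the annihilating product, so `ℓ_α(x)` is an eigenvector
  -- of `L_x`.
  have heig : ∀ α ∈ s, x * aeval (mulL x) (Lagrange.basis s id α) 1 =
      α • aeval (mulL x) (Lagrange.basis s id α) 1 := by
    intro α hα
    have h : (X - C α) * Lagrange.basis s id α =
        (∏ β ∈ s, (X - C β)) * C (∏ β ∈ s.erase α, (α - β)⁻¹) := by
      rw [Lagrange.basis, ← Finset.mul_prod_erase s _ hα, mul_assoc, map_prod,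
        ← Finset.prod_mul_distrib]
      congr 1
      refine Finset.prod_congr rfl fun β _ => ?_
      rw [Lagrange.basisDivisor, mul_comm]
      rfl
    have h2 := congrArg (fun p => aeval (mulL x) p (1 : V)) h
    simp only [map_mul (aeval (mulL x)), hsx, zero_mul, LinearMap.zero_apply,
      Module.End.mul_apply, map_sub, aeval_X, aeval_C, LinearMap.sub_apply, LinearMap.mulLeft_apply,
      Module.algebraMap_end_apply] at h2
    exact sub_eq_zero.1 h2
  have hmul : ∀ α ∈ s, ∀ β, aeval (mulL x) (Lagrange.basis s id α) 1 *
      aeval (mulL x) (Lagrange.basis s id β) 1 =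
      (Lagrange.basis s id β).eval α • aeval (mulL x) (Lagrange.basis s id α) 1 := by
    intro α hα β
    rw [aeval_mul_aeval, mul_comm, map_mul, Module.End.mul_apply,
      aeval_eigenvector _ (heig α hα)]
  have hsum : ∑ α ∈ s, aeval (mulL x) (Lagrange.basis s id α) 1 = (1 : V) := by
    -- Without nodes the annihilating product is `1`, so `V` is zero.
    rcases s.eq_empty_or_nonempty with rfl | hne
    · have h := LinearMap.congr_fun hsx 1
      simpa using h.symm
    · rw [← LinearMap.sum_apply, ← map_sum, Lagrange.sum_basis (Set.injOn_id _) hne]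
      simp
  refine ⟨s, fun α => aeval (mulL x) (Lagrange.basis s id α) 1, fun α hα => ?_,
    fun α hα β hβ hne => ?_, hsum, ?_, heig, fun α S h1 hS => aeval_mem _ S h1 hS _⟩
  · have := Lagrange.eval_basis_self (Set.injOn_id (s : Set ℝ)) hα
    rw [hmul α hα, show eval α _ = 1 from this, one_smul]
  · have := Lagrange.eval_basis_of_ne (v := id) hne.symm hα
    rw [hmul α hα, show eval α _ = 0 from this, zero_smul]
  · rw [← Finset.sum_congr rfl heig, ← Finset.mul_sum, hsum, mul_one]

end Spectral
-- Orthogonal systems of primitive idempotents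
section Systems

variable {V : Type*} [NonAssocCommRing V] [Module ℝ V] [IsScalarTower ℝ V V]
  [SMulCommClass ℝ V V] [EuclideanJordanAlgebra V]

/-- A complete system of nonzero orthogonal idempotents. -/
structure IsIdempotentSystem (t : Finset V) : Prop where
  ne_zero : ∀ c ∈ t, c ≠ 0
  idem : ∀ c ∈ t, c * c = c
  orth : ∀ c ∈ t, ∀ d ∈ t, c ≠ d → c * d = 0
  sum_eq : ∑ c ∈ t, c = 1

theorem IsIdempotentSystem.linearIndependent {t : Finset V} (ht : IsIdempotentSystem t) :
    LinearIndependent ℝ (Subtype.val : t → V) := by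
  rw [Fintype.linearIndependent_iff]
  intro g hg i
  have h := congrArg (fun x => (i : V) * x) hg
  simp only [Finset.mul_sum, mul_zero, mul_smul_comm] at h
  rw [Finset.sum_eq_single i] at h
  · rw [ht.idem _ i.2] at h
    exact (smul_eq_zero.1 h).resolve_right (ht.ne_zero _ i.2)
  · intro j _ hj
    rw [ht.orth _ i.2 _ j.2 (fun h => hj (Subtype.ext h.symm)), smul_zero]
  · simp

theorem IsIdempotentSystem.card_le {t : Finset V} (ht : IsIdempotentSystem t) :
    t.card ≤ Module.finrank ℝ V := by
  simpa using ht.linearIndependent.fintype_card_le_finrank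

/-- `IsPrimitive` does not ask the two summands to be orthogonal; this shows that they are. -/
theorem mul_eq_zero_of_add {p q : V} (hp : p * p = p) (hq : q * q = q)
    (h : (p + q) * (p + q) = p + q) : p * q = 0 := by
  rw [mul_add, add_mul, add_mul, hp, hq, mul_comm q p] at h
  linear_combination (norm := module) (1 / 2 : ℝ) • h

theorem IsIdempotentSystem.exists_primitive_refinement {t : Finset V}
    (ht : IsIdempotentSystem t) : ∃ t' : Finset V, IsIdempotentSystem t' ∧
      (∀ c ∈ t', IsPrimitive c) ∧ Submodule.span ℝ (t : Set V) ≤ Submodule.span ℝ (t' : Set V) := by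
  classical
  -- Splitting a non-primitive member adds one element, and linear independence bounds the size by
  -- the dimension.
  induction h : Module.finrank ℝ V - t.card using Nat.strong_induction_on generalizing t with
  | _ n ih =>
  by_cases hprim : ∀ c ∈ t, IsPrimitive c
  · exact ⟨t, ht, hprim, le_rfl⟩
  push Not at hprim
  obtain ⟨c, hc, hcp⟩ := hprim
  have hcc := ht.idem c hc
  rw [IsPrimitive] at hcp
  push Not at hcp
  obtain ⟨p, q, hp0, hq0, hp, hq, hpq⟩ := hcp (ht.ne_zero c hc) hcc
  have hpq0 : p * q = 0 := mul_eq_zero_of_add hp hq (by rwa [← hpq])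
  have hcp : c * p = p := by rw [hpq, add_mul, hp, mul_comm q, hpq0, add_zero]
  have hcq : c * q = q := by rw [hpq, add_mul, hq, hpq0, zero_add]
  have hpd : ∀ d ∈ t.erase c, p * d = 0 := fun d hd =>
    peirce_one_mul_zero hcc hcp (ht.orth c hc d (Finset.mem_of_mem_erase hd)
      (Finset.ne_of_mem_erase hd).symm)
  have hqd : ∀ d ∈ t.erase c, q * d = 0 := fun d hd =>
    peirce_one_mul_zero hcc hcq (ht.orth c hc d (Finset.mem_of_mem_erase hd)
      (Finset.ne_of_mem_erase hd).symm)
  have hp' : p ∉ t.erase c := fun h => hp0 (by rw [← hp, hpd p h])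
  have hq' : q ∉ t.erase c := fun h => hq0 (by rw [← hq, hqd q h])
  have hne : p ≠ q := fun h => hp0 (by rw [← hp]; nth_rw 2 [h]; exact hpq0)
  have hpi : p ∉ insert q (t.erase c) := by
    rw [Finset.mem_insert, not_or]; exact ⟨hne, hp'⟩
  have hsys : IsIdempotentSystem (insert p (insert q (t.erase c))) := by
    refine ⟨?_, ?_, ?_, ?_⟩
    · simp only [Finset.forall_mem_insert]
      exact ⟨hp0, hq0, fun d hd => ht.ne_zero d (Finset.mem_of_mem_erase hd)⟩
    · simp only [Finset.forall_mem_insert]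
      exact ⟨hp, hq, fun d hd => ht.idem d (Finset.mem_of_mem_erase hd)⟩
    · simp only [Finset.forall_mem_insert]
      refine ⟨⟨fun h => absurd rfl h, fun _ => hpq0, fun d hd _ => hpd d hd⟩,
        ⟨fun _ => by rw [mul_comm, hpq0], fun h => absurd rfl h, fun d hd _ => hqd d hd⟩,
        fun d hd => ⟨fun _ => by rw [mul_comm, hpd d hd], fun _ => by rw [mul_comm, hqd d hd],
          fun b hb => ht.orth d (Finset.mem_of_mem_erase hd) b (Finset.mem_of_mem_erase hb)⟩⟩
    · rw [Finset.sum_insert hpi, Finset.sum_insert hq', ← add_assoc, ← hpq,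
        Finset.add_sum_erase _ (fun x => x) hc, ht.sum_eq]
  have hcard : (insert p (insert q (t.erase c))).card = t.card + 1 := by
    rw [Finset.card_insert_of_notMem hpi, Finset.card_insert_of_notMem hq',
      Finset.card_erase_add_one hc]
  have hle := hsys.card_le
  obtain ⟨t', h1, h2, h3⟩ := ih _ (by omega) hsys rfl
  refine ⟨t', h1, h2, le_trans (Submodule.span_le.2 fun d hd => ?_) h3⟩
  rcases eq_or_ne d c with rfl | hdc
  · rw [SetLike.mem_coe, hpq]
    exact add_mem (Submodule.subset_span (by simp)) (Submodule.subset_span (by simp))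
  · exact Submodule.subset_span (by simp [hdc]; exact Or.inr (Or.inr hd))

/-- Zero members are dropped; equal nonzero members with different indices would be orthogonal to
themselves. -/
theorem exists_system_of_family {ι : Type*} (s : Finset ι) (e : ι → V)
    (hidem : ∀ i ∈ s, e i * e i = e i) (horth : ∀ i ∈ s, ∀ j ∈ s, i ≠ j → e i * e j = 0)
    (hsum : ∑ i ∈ s, e i = 1) :
    ∃ t : Finset V, IsIdempotentSystem t ∧ ∀ i ∈ s, e i ∈ Submodule.span ℝ (t : Set V) := by
  classical
  refine ⟨(s.filter (e · ≠ 0)).image e, ⟨?_, ?_, ?_, ?_⟩, fun i hi => ?_⟩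
  · simp only [Finset.forall_mem_image, Finset.mem_filter]
    exact fun i hi => hi.2
  · simp only [Finset.forall_mem_image, Finset.mem_filter]
    exact fun i hi => hidem i hi.1
  · simp only [Finset.forall_mem_image, Finset.mem_filter]
    exact fun i hi j hj hne => horth i hi.1 j hj.1 (fun h => hne (h ▸ rfl))
  · rw [Finset.sum_image, Finset.sum_filter_ne_zero, hsum]
    intro i hi j hj hij
    simp only [Finset.coe_filter, Set.mem_ofPred_eq] at hi hj
    by_contra hne
    have := horth i hi.1 j hj.1 hne
    rw [← hij, hidem i hi.1] at this
    exact hi.2 this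
  · by_cases h : e i = 0
    · rw [h]; exact zero_mem _
    · exact Submodule.subset_span (by simpa using ⟨i, ⟨hi, h⟩, rfl⟩)

/-- The elements without Peirce one-half component relative to an idempotent `c`. -/
def peirceEven (c : V) : Submodule ℝ V where
  carrier := {y | c * (c * y) = c * y}
  add_mem' {y z} hy hz := by
    simp only [Set.mem_ofPred_eq] at *
    rw [mul_add, mul_add, hy, hz]
  zero_mem' := by simp
  smul_mem' r y hy := by
    simp only [Set.mem_ofPred_eq] at *
    rw [mul_smul_comm, mul_smul_comm, hy]

/-- The spectral idempotents of `x` with nonzero eigenvalue lie in the Peirce one space of `c`, so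
each of them is `0` or `c`; otherwise it would split `c`. -/
theorem IsPrimitive.eq_smul {c x : V} (hc : IsPrimitive c) (hx : c * x = x) :
    ∃ r : ℝ, x = r • c := by
  obtain ⟨hc0, hcc, hsplit⟩ := hc
  obtain ⟨s, u, hidem, horth, hsum, hxu, heig, hmem⟩ := exists_spectral_decomposition x
  have hux : ∀ α ∈ s, α ≠ 0 → c * u α = u α := by
    intro α hα h0
    have h1 : c * (c * u α) = c * u α := by
      exact hmem α (peirceEven c) (by simp [peirceEven, hcc]) fun y hy =>
        peirce_mul_mem hcc (by rw [hx, hx]) hy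
    have h2 : x * (c * u α) = x * u α := by
      rw [← sub_eq_zero, ← mul_sub]
      exact peirce_one_mul_zero hcc hx (by rw [mul_sub, h1, sub_self])
    have h3 := peirce_commute hcc (u := x) (by rw [hx, hx]) (u α)
    rw [h2, heig α hα, mul_smul_comm] at h3
    exact (smul_right_inj h0).1 h3
  have hu : ∀ α ∈ s, α ≠ 0 → u α = 0 ∨ u α = c := by
    intro α hα h0
    by_contra! h
    refine hsplit ⟨u α, c - u α, h.1, sub_ne_zero.2 h.2.symm, hidem α hα, ?_, by abel⟩
    rw [sub_mul, mul_sub, mul_sub, hcc, hidem α hα, hux α hα h0, mul_comm, hux α hα h0]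
    abel
  have : x ∈ Submodule.span ℝ {c} := by
    rw [hxu]
    refine Submodule.sum_mem _ fun α hα => ?_
    by_cases h0 : α = 0
    · rw [h0, zero_smul]; exact zero_mem _
    rcases hu α hα h0 with h | h
    · rw [h, smul_zero]; exact zero_mem _
    · rw [h]; exact Submodule.smul_mem _ _ (Submodule.mem_span_singleton_self c)
  obtain ⟨r, hr⟩ := Submodule.mem_span_singleton.1 this
  exact ⟨r, hr.symm⟩

/-- Operator commuting elements are combinations of a common primitive system. -/
theorem exists_common_system {a d : V} (h : a * (a * d) = (a * a) * d) :
    ∃ t : Finset V, IsIdempotentSystem t ∧ (∀ c ∈ t, IsPrimitive c) ∧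
      a ∈ Submodule.span ℝ (t : Set V) ∧ d ∈ Submodule.span ℝ (t : Set V) := by
  obtain ⟨B, hs, hp, ha⟩ := EuclideanJordanAlgebra.exists_inner (V := V)
  obtain ⟨s, u, hidem, horth, hsum, hau, heig, -⟩ := exists_spectral_decomposition a
  have hsumd : ∀ y : V, ∑ β ∈ s, u β * y = y := fun y => by
    rw [← Finset.sum_mul, hsum, one_mul]
  have hcomm : ∀ α ∈ s, ∀ β ∈ s, ∀ y, u α * (u β * y) = u β * (u α * y) := by
    intro α hα β hβ y
    rcases eq_or_ne α β with rfl | hne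
    · rfl
    · exact orthogonal_commute (hidem α hα) (horth α hα β hβ hne) y
  -- `h1`, `h2`, `h3` combine to `∑ (α - β)² B(d, u_α(u_β d)) = 0`.
  have h1 : ∑ α ∈ s, ∑ β ∈ s, α ^ 2 * B d (u α * (u β * d)) = B d ((a * a) * d) := by
    have haa : a * a = ∑ α ∈ s, α ^ 2 • u α := by
      have : a * a = a * ∑ α ∈ s, α • u α := congrArg (a * ·) hau
      rw [this, Finset.mul_sum]
      refine Finset.sum_congr rfl fun α hα => ?_
      rw [mul_smul_comm, heig α hα, smul_smul, pow_two]
    rw [haa, Finset.sum_mul, map_sum]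
    refine Finset.sum_congr rfl fun α _ => ?_
    rw [← Finset.mul_sum, ← map_sum, ← Finset.mul_sum, hsumd, smul_mul_assoc, map_smul,
      smul_eq_mul]
  have h2 : ∑ α ∈ s, ∑ β ∈ s, α * β * B d (u α * (u β * d)) = B d (a * (a * d)) := by
    conv_rhs => rw [hau, Finset.sum_mul, Finset.sum_mul, map_sum]
    refine Finset.sum_congr rfl fun α _ => ?_
    rw [Finset.mul_sum, map_sum]
    refine Finset.sum_congr rfl fun β _ => ?_
    simp [smul_mul_assoc, mul_smul_comm, mul_assoc, mul_left_comm]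
  have h3 : ∑ α ∈ s, ∑ β ∈ s, β ^ 2 * B d (u α * (u β * d)) = B d ((a * a) * d) := by
    rw [← h1, Finset.sum_comm]
    refine Finset.sum_congr rfl fun α hα => Finset.sum_congr rfl fun β hβ => ?_
    rw [hcomm β hβ α hα]
  -- `4 L_{u_α} L_{u_β}` is an orthogonal projection, so every term of that sum is nonnegative and
  -- must vanish.
  have hquarter : ∀ α ∈ s, ∀ β ∈ s, α ≠ β → B d (u α * (u β * d)) =
      4 * B (u α * (u β * d)) (u α * (u β * d)) := by
    intro α hα β hβ hne
    rw [ha, ha, hcomm β hβ α hα,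
      orthogonal_mul_mul (hidem α hα) (hidem β hβ) (horth α hα β hβ hne), map_smul, smul_eq_mul]
    ring
  have hnonneg : ∀ y, 0 ≤ B y y := fun y => by
    rcases eq_or_ne y 0 with rfl | hy
    · simp
    · exact (hp y hy).le
  have h4 : ∑ α ∈ s, ∑ β ∈ s, (α - β) ^ 2 * B d (u α * (u β * d)) = 0 := by
    have : ∑ α ∈ s, ∑ β ∈ s, (α - β) ^ 2 * B d (u α * (u β * d)) =
        B d ((a * a) * d) + B d ((a * a) * d) - 2 * B d (a * (a * d)) := by
      nth_rw 1 [← h1]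
      rw [← h2, ← h3, Finset.mul_sum, ← Finset.sum_add_distrib, ← Finset.sum_sub_distrib]
      refine Finset.sum_congr rfl fun α _ => ?_
      rw [Finset.mul_sum, ← Finset.sum_add_distrib, ← Finset.sum_sub_distrib]
      exact Finset.sum_congr rfl fun β _ => by ring
    rw [this, h]
    ring
  have h5 : ∀ α ∈ s, ∀ β ∈ s, 0 ≤ (α - β) ^ 2 * B d (u α * (u β * d)) := by
    intro α hα β hβ
    rcases eq_or_ne α β with rfl | hne
    · simp
    · rw [hquarter α hα β hβ hne]
      have := hnonneg (u α * (u β * d))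
      positivity
  have hzero : ∀ α ∈ s, ∀ β ∈ s, α ≠ β → u α * (u β * d) = 0 := by
    intro α hα β hβ hne
    have h6 := (Finset.sum_eq_zero_iff_of_nonneg fun α hα =>
      Finset.sum_nonneg (h5 α hα)).1 h4 α hα
    have h7 := (Finset.sum_eq_zero_iff_of_nonneg (h5 α hα)).1 h6 β hβ
    rw [hquarter α hα β hβ hne] at h7
    have h8 : (α - β) ^ 2 ≠ 0 := pow_ne_zero _ (sub_ne_zero.2 hne)
    by_contra hy
    have := hp _ hy
    have h9 := (mul_eq_zero.1 h7).resolve_left h8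
    linarith
  have hd : ∀ α ∈ s, u α * (u α * d) = u α * d := by
    intro α hα
    have := hsumd (u α * d)
    rw [Finset.sum_eq_single_of_mem α hα] at this
    · exact this
    · exact fun β hβ hne => hzero β hβ α hα hne
  obtain ⟨s', v, hidem', horth', hsum', hdv, heig', hmem⟩ := exists_spectral_decomposition d
  -- `d` has no half component relative to `u_α`; such elements form a subspace stable under `d`, so
  -- it contains the spectral idempotents of `d`, and the products `u_α v_γ` are orthogonal
  -- idempotents.
  have hv : ∀ α ∈ s, ∀ γ, u α * (u α * v γ) = u α * v γ := by
    intro α hα γ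
    exact hmem γ (peirceEven (u α)) (by simp [peirceEven, hidem α hα]) fun y hy =>
      peirce_mul_mem (hidem α hα) (hd α hα) hy
  have hprod : ∀ α ∈ s, ∀ γ γ', (u α * v γ) * (u α * v γ') = u α * (v γ * v γ') :=
    fun α hα γ γ' => peirce_component_mul (hidem α hα) (hv α hα γ) (hv α hα γ')
  obtain ⟨t, ht, htm⟩ := exists_system_of_family (s ×ˢ s') (fun i => u i.1 * v i.2)
    (fun i hi => by
      rw [Finset.mem_product] at hi
      rw [hprod _ hi.1, hidem' _ hi.2])
    (fun i hi j hj hne => by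
      rw [Finset.mem_product] at hi hj
      by_cases h1 : i.1 = j.1
      · rw [h1, hprod _ hj.1, horth' _ hi.2 _ hj.2 (fun h2 => hne (Prod.ext h1 h2)), mul_zero]
      · refine peirce_one_mul_zero (hidem _ hi.1) (hv _ hi.1 _) ?_
        rw [mul_comm (u j.1), peirce_commute (hidem _ hi.1) (hv _ hi.1 _),
          horth _ hi.1 _ hj.1 h1, mul_zero])
    (by rw [Finset.sum_product, ← Finset.sum_mul_sum, hsum, hsum', one_mul])
  obtain ⟨t', ht', hprim, hle⟩ := ht.exists_primitive_refinement
  refine ⟨t', ht', hprim, hle ?_, hle ?_⟩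
  · have : a = ∑ α ∈ s, ∑ γ ∈ s', α • (u α * v γ) := by
      conv_lhs => rw [hau]
      refine Finset.sum_congr rfl fun α _ => ?_
      rw [← Finset.smul_sum, ← Finset.mul_sum, hsum', mul_one]
    rw [this]
    exact sum_mem fun α hα => sum_mem fun γ hγ =>
      Submodule.smul_mem _ _ (htm (α, γ) (Finset.mem_product.2 ⟨hα, hγ⟩))
  · have : d = ∑ α ∈ s, ∑ γ ∈ s', γ • (u α * v γ) := by
      rw [Finset.sum_comm]
      conv_lhs => rw [hdv]
      refine Finset.sum_congr rfl fun γ _ => ?_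
      rw [← Finset.smul_sum, hsumd]
    rw [this]
    exact sum_mem fun α hα => sum_mem fun γ hγ =>
      Submodule.smul_mem _ _ (htm (α, γ) (Finset.mem_product.2 ⟨hα, hγ⟩))

end Systems
-- The trace functional, rank and uniqueness of eigenvalues
section Trace

open Polynomial

variable {V : Type*} [NonAssocCommRing V] [Module ℝ V] [IsScalarTower ℝ V V]
  [SMulCommClass ℝ V V] [EuclideanJordanAlgebra V]

local notation "mulL" => LinearMap.mulLeft ℝ

/-- Primitivity gives `P(c)d = βc` and `P(d)c = γd`, whence `B(c,d) = β B(c,c) = γ B(d,d)`. Applying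
`P(c)P(d)c = (P(c)d)²` yields `γβ = β²`, so `γ = β ≠ 0`. -/
theorem IsPrimitive.norm_eq {B : V →ₗ[ℝ] V →ₗ[ℝ] ℝ} (hs : ∀ x y, B x y = B y x)
    (ha : ∀ x y z, B (x * y) z = B y (x * z)) {c d : V} (hc : IsPrimitive c) (hd : IsPrimitive d)
    (h : B c d ≠ 0) : B c c = B d d := by
  have hcc := hc.2.1
  have hdd := hd.2.1
  obtain ⟨β, hβ⟩ := hc.eq_smul (peirce_one_component hcc d)
  obtain ⟨γ, hγ⟩ := hd.eq_smul (peirce_one_component hdd c)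
  have h1 : B c d = β * B c c := by
    have := congrArg (fun x => B x c) hβ
    simp only [map_sub, map_smul, LinearMap.sub_apply, LinearMap.smul_apply, smul_eq_mul, ha,
      hcc] at this
    rw [hs c d]
    linarith
  have h2 : B c d = γ * B d d := by
    have := congrArg (fun x => B x d) hγ
    simp only [map_sub, map_smul, LinearMap.sub_apply, LinearMap.smul_apply, smul_eq_mul, ha,
      hdd] at this
    linarith
  have h3 := quadratic_idempotent hcc d
  simp only [hdd, hγ, hβ] at h3
  have h4 : γ • (β • c) = (β * β) • c := by
    have : γ • ((2 : ℝ) • (c * (c * d)) - c * d) = (β * β) • c := by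
      rw [← sub_eq_zero] at h3 ⊢
      rw [← h3]
      simp only [mul_smul_comm, smul_mul_assoc, hcc]
      module
    rwa [hβ] at this
  rw [smul_smul] at h4
  have h5 : γ * β = β * β := smul_left_injective ℝ hc.1 h4
  have hβ0 : β ≠ 0 := by rintro rfl; simp at h1; exact h h1
  have h6 : γ = β := mul_right_cancel₀ hβ0 h5
  rw [h6, h1] at h2
  exact mul_left_cancel₀ hβ0 h2

variable (V) in
theorem exists_primitive_system : ∃ t : Finset V, IsIdempotentSystem t ∧
    ∀ c ∈ t, IsPrimitive c := by
  obtain ⟨t, h1, h2, -⟩ := exists_common_system (V := V) (a := 0) (d := 0) (by simp)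
  exact ⟨t, h1, h2⟩

-- Fix a primitive system and normalize `B(e, ·)` by `B(e,e)`. Where `B(e,c) ≠ 0`, `norm_eq`
-- replaces `B(e,e)` by `B(c,c)`, so the sum at `c` is `B(1,c) / B(c,c) = 1`.
variable (V) in
theorem exists_trace : ∃ T : V →ₗ[ℝ] ℝ, ∀ c, IsPrimitive c → T c = 1 := by
  obtain ⟨B, hs, hp, ha⟩ := EuclideanJordanAlgebra.exists_inner (V := V)
  obtain ⟨t, ht, hprim⟩ := exists_primitive_system V
  refine ⟨∑ e ∈ t, (B e e)⁻¹ • B e, fun c hc => ?_⟩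
  have hcc : B c c ≠ 0 := (hp c hc.1).ne'
  calc (∑ e ∈ t, (B e e)⁻¹ • B e) c = ∑ e ∈ t, (B c c)⁻¹ * B e c := by
        rw [LinearMap.sum_apply]
        refine Finset.sum_congr rfl fun e he => ?_
        by_cases h : B e c = 0
        · simp [h]
        · simp [(hprim e he).norm_eq hs ha hc h]
    _ = (B c c)⁻¹ * B (∑ e ∈ t, e) c := by
        rw [map_sum, LinearMap.sum_apply, Finset.mul_sum]
    _ = 1 := by
        have : B 1 c = B c c := by
          conv_rhs => rw [← mul_one c, ha, mul_one, hc.2.1]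
        rw [ht.sum_eq, this, inv_mul_cancel₀ hcc]

variable (V) in
/-- The linear functional which is `1` at every primitive idempotent. -/
noncomputable def trace : V →ₗ[ℝ] ℝ := Classical.choose (exists_trace V)

theorem trace_primitive {c : V} (hc : IsPrimitive c) : trace V c = 1 :=
  Classical.choose_spec (exists_trace V) c hc

theorem IsIdempotentSystem.card_eq_trace {t : Finset V} (ht : IsIdempotentSystem t)
    (hprim : ∀ c ∈ t, IsPrimitive c) : (t.card : ℝ) = trace V 1 := by
  rw [← ht.sum_eq, map_sum, Finset.sum_congr rfl fun c hc => trace_primitive (hprim c hc)]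
  simp

theorem IsIdempotentSystem.mul_mem_span {t : Finset V} (ht : IsIdempotentSystem t) {x y : V}
    (hx : x ∈ Submodule.span ℝ (t : Set V)) (hy : y ∈ Submodule.span ℝ (t : Set V)) :
    x * y ∈ Submodule.span ℝ (t : Set V) := by
  induction hx, hy using Submodule.span_induction₂ with
  | mem_mem c d hc hd =>
    by_cases h : c = d
    · subst h
      rw [ht.idem _ hc]
      exact Submodule.subset_span hc
    · rw [ht.orth _ hc _ hd h]; exact zero_mem _
  | zero_left y hy => rw [zero_mul]; exact zero_mem _
  | zero_right y hy => rw [mul_zero]; exact zero_mem _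
  | add_left x y z _ _ _ h1 h2 => rw [add_mul]; exact add_mem h1 h2
  | add_right x y z _ _ _ h1 h2 => rw [mul_add]; exact add_mem h1 h2
  | smul_left r x y _ _ h => rw [smul_mul_assoc]; exact Submodule.smul_mem _ _ h
  | smul_right r x y _ _ h => rw [mul_smul_comm]; exact Submodule.smul_mem _ _ h

theorem IsIdempotentSystem.degree_le {t : Finset V} (ht : IsIdempotentSystem t) {x : V}
    (hx : x ∈ Submodule.span ℝ (t : Set V)) : degree x ≤ t.card := by
  refine le_trans (Submodule.finrank_mono (Submodule.span_le.2 ?_)) (finrank_span_finset_le_card t)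
  rintro _ ⟨n, rfl⟩
  induction n with
  | zero =>
    rw [SetLike.mem_coe, jpow, ← ht.sum_eq]
    exact sum_mem fun c hc => Submodule.subset_span hc
  | succ n ih => exact ht.mul_mem_span hx ih

theorem mul_mem_span_jpow {x y : V} (hy : y ∈ Submodule.span ℝ (Set.range (jpow x))) :
    x * y ∈ Submodule.span ℝ (Set.range (jpow x)) := by
  induction hy using Submodule.span_induction with
  | mem y hy =>
    obtain ⟨n, rfl⟩ := hy
    exact Submodule.subset_span ⟨n + 1, rfl⟩
  | zero => rw [mul_zero]; exact zero_mem _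
  | add y z _ _ h1 h2 => rw [mul_add]; exact add_mem h1 h2
  | smul r y _ h => rw [mul_smul_comm]; exact Submodule.smul_mem _ _ h

theorem aeval_sum_idempotents {ι : Type*} [Fintype ι] {e : ι → V}
    (hidem : ∀ i, e i * e i = e i) (horth : ∀ i j, i ≠ j → e i * e j = 0) (hsum : ∑ i, e i = 1)
    (μ : ι → ℝ) (p : ℝ[X]) :
    aeval (mulL (∑ i, μ i • e i)) p 1 = ∑ i, p.eval (μ i) • e i := by
  classical
  rw [← hsum, map_sum]
  refine Finset.sum_congr rfl fun i _ => aeval_eigenvector _ ?_ p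
  rw [LinearMap.mulLeft_apply, Finset.sum_mul, Finset.sum_eq_single i]
  · rw [smul_mul_assoc, hidem]
  · intro j _ hj
    rw [smul_mul_assoc, horth j i hj, smul_zero]
  · simp

theorem eval_lagrange_basis {s : Finset ℝ} {α β : ℝ} (hα : α ∈ s) (hβ : β ∈ s) :
    (Lagrange.basis s id α).eval β = if β = α then 1 else 0 := by
  split_ifs with h
  · subst h
    exact Lagrange.eval_basis_self (Set.injOn_id (s : Set ℝ)) hα
  · exact Lagrange.eval_basis_of_ne (v := id) (Ne.symm h) hβ

/-- All primitive systems have the same size, the trace of `1`, and each element lies in the span of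
one, which bounds its degree. The bound is attained by a combination with distinct coefficients,
whose Lagrange polynomials recover all of `t`. -/
theorem IsIdempotentSystem.card_eq_rank {t : Finset V} (ht : IsIdempotentSystem t)
    (hprim : ∀ c ∈ t, IsPrimitive c) : t.card = rank V := by
  classical
  have hle : ∀ x : V, degree x ≤ t.card := by
    intro x
    obtain ⟨t', ht', hprim', hx, -⟩ := exists_common_system (a := x) (d := 0) (by simp)
    have h := (ht.card_eq_trace hprim).trans (ht'.card_eq_trace hprim').symm
    rw [Nat.cast_inj.1 h]
    exact ht'.degree_le hx
  refine le_antisymm ?_ (ciSup_le hle)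
  let e : t → V := Subtype.val
  have hidem : ∀ i, e i * e i = e i := fun i => ht.idem _ i.2
  have horth : ∀ i j, i ≠ j → e i * e j = 0 := fun i j h =>
    ht.orth _ i.2 _ j.2 fun h' => h (Subtype.ext h')
  have hsum : ∑ i, e i = 1 := by rw [← ht.sum_eq]; exact Finset.sum_coe_sort t (fun x => x)
  let μ : t → ℝ := fun i => (t.equivFin i : ℕ)
  have hμ : Function.Injective μ := fun i j h => by
    have h' : ((t.equivFin i : ℕ) : ℝ) = (t.equivFin j : ℕ) := h
    exact t.equivFin.injective (Fin.ext (Nat.cast_injective h'))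
  obtain ⟨x, hx⟩ : ∃ x, x = ∑ i, μ i • e i := ⟨_, rfl⟩
  have hspan : Submodule.span ℝ (t : Set V) ≤ Submodule.span ℝ (Set.range (jpow x)) := by
    refine Submodule.span_le.2 fun c hc => ?_
    have h1 := aeval_mem (mulL x) (Submodule.span ℝ (Set.range (jpow x)))
      (Submodule.subset_span ⟨0, rfl⟩) (fun y hy => mul_mem_span_jpow hy)
      (Lagrange.basis (Finset.univ.image μ) id (μ ⟨c, hc⟩))
    have h2 : aeval (mulL x) (Lagrange.basis (Finset.univ.image μ) id (μ ⟨c, hc⟩)) 1 = c := by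
      rw [hx, aeval_sum_idempotents hidem horth hsum, Finset.sum_eq_single ⟨c, hc⟩]
      · rw [eval_lagrange_basis (by simp) (by simp), if_pos rfl, one_smul]
      · intro j _ hj
        rw [eval_lagrange_basis (by simp) (by simp), if_neg (fun h => hj (hμ h)), zero_smul]
      · simp
    have h3 : jpow x 0 = 1 := rfl
    rw [h3, h2] at h1
    exact h1
  have hfin : Module.finrank ℝ (Submodule.span ℝ (t : Set V)) = t.card :=
    finrank_span_finset_eq_card ht.linearIndependent
  calc t.card = Module.finrank ℝ (Submodule.span ℝ (t : Set V)) := hfin.symm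
    _ ≤ degree x := Submodule.finrank_mono hspan
    _ ≤ rank V := le_ciSup (f := fun x : V => degree x) ⟨t.card, by rintro _ ⟨x, rfl⟩; exact hle x⟩ x

theorem IsJordanFrame.idem {e : Fin (rank V) → V} (he : IsJordanFrame e) (i) :
    e i * e i = e i := (he.1 i).2.1

theorem exists_common_frame {a d : V} (h : a * (a * d) = (a * a) * d) :
    ∃ (e : Fin (rank V) → V) (μ ν : Fin (rank V) → ℝ), IsJordanFrame e ∧
      a = ∑ i, μ i • e i ∧ d = ∑ i, ν i • e i := by
  obtain ⟨t, ht, hprim, hat, hdt⟩ := exists_common_system h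
  let φ := t.equivFinOfCardEq (ht.card_eq_rank hprim)
  let e : Fin (rank V) → V := fun i => φ.symm i
  have hr : (t : Set V) = Set.range e := by
    ext x
    constructor
    · exact fun hx => ⟨φ ⟨x, hx⟩, by simp [e]⟩
    · rintro ⟨i, rfl⟩; exact (φ.symm i).2
  rw [hr, Submodule.mem_span_range_iff_exists_fun] at hat hdt
  obtain ⟨μ, hμ⟩ := hat
  obtain ⟨ν, hν⟩ := hdt
  refine ⟨e, μ, ν, ⟨fun i => hprim _ (φ.symm i).2, fun i j hij => ?_, ?_⟩, hμ.symm, hν.symm⟩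
  · exact ht.orth _ (φ.symm i).2 _ (φ.symm j).2
      fun h => hij (φ.symm.injective (Subtype.ext h))
  · rw [← ht.sum_eq, ← Finset.sum_coe_sort t]
    exact Equiv.sum_comp φ.symm (fun i => (i : V))

theorem IsJordanFrame.comp_perm {e : Fin (rank V) → V} (he : IsJordanFrame e)
    (σ : Equiv.Perm (Fin (rank V))) : IsJordanFrame (e ∘ σ) :=
  ⟨fun i => he.1 _, fun i j h => he.2.1 _ _ (fun h' => h (σ.injective h')), by
    rw [← he.2.2]; exact Equiv.sum_comp σ e⟩

/-- The coefficients of an element relative to Jordan frames are unique up to permutation. -/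
theorem IsJordanFrame.exists_perm {e f : Fin (rank V) → V} (he : IsJordanFrame e)
    (hf : IsJordanFrame f) {μ ν : Fin (rank V) → ℝ} (h : ∑ i, μ i • e i = ∑ i, ν i • f i) :
    ∃ σ : Equiv.Perm (Fin (rank V)), μ ∘ σ = ν := by
  classical
  have hcard : ∀ α, Fintype.card {i // ν i = α} = Fintype.card {i // μ i = α} := by
    intro α
    -- The trace of `ℓ_α(x)` counts the indices with coefficient `α`, in either frame; the nodes
    -- must include all values and `α`.
    let s : Finset ℝ := insert α (Finset.univ.image μ ∪ Finset.univ.image ν)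
    have h1 := aeval_sum_idempotents he.idem he.2.1 he.2.2 μ (Lagrange.basis s id α)
    rw [h, aeval_sum_idempotents hf.idem hf.2.1 hf.2.2 ν (Lagrange.basis s id α)] at h1
    have h2 := congrArg (trace V) h1
    simp only [map_sum, map_smul, trace_primitive (he.1 _), trace_primitive (hf.1 _),
      smul_eq_mul, mul_one] at h2
    have h3 : ∀ i, (Lagrange.basis s id α).eval (μ i) = if μ i = α then 1 else 0 := fun i =>
      eval_lagrange_basis (by simp [s]) (by simp [s])
    have h4 : ∀ i, (Lagrange.basis s id α).eval (ν i) = if ν i = α then 1 else 0 := fun i =>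
      eval_lagrange_basis (by simp [s]) (by simp [s])
    simp only [h3, h4, Finset.sum_boole, Nat.cast_inj] at h2
    rw [Fintype.card_subtype, Fintype.card_subtype, h2]
  refine ⟨Equiv.ofFiberEquiv (f := ν) (g := μ) fun α => Fintype.equivOfCardEq (hcard α), ?_⟩
  funext i
  exact Equiv.ofFiberEquiv_map _ i

theorem antitone_comp_unique {n : ℕ} {μ : Fin n → ℝ} {σ τ : Equiv.Perm (Fin n)}
    (hσ : Antitone (μ ∘ σ)) (hτ : Antitone (μ ∘ τ)) : μ ∘ σ = μ ∘ τ := by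
  have := Tuple.unique_monotone (f := fun i => -μ i) (σ := σ) (τ := τ)
    (fun i j h => neg_le_neg (hσ h)) (fun i j h => neg_le_neg (hτ h))
  funext i
  simpa using congrFun this i

theorem sum_comp_perm (μ : Fin (rank V) → ℝ) (e : Fin (rank V) → V)
    (σ : Equiv.Perm (Fin (rank V))) : ∑ i, (μ ∘ σ) i • (e ∘ σ) i = ∑ i, μ i • e i :=
  Equiv.sum_comp σ (fun i => μ i • e i)

theorem isEigenvalueVector_eigenvalues (x : V) : IsEigenvalueVector x (eigenvalues x) := by
  refine Classical.epsilon_spec (p := IsEigenvalueVector x) ?_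
  obtain ⟨e, μ, -, he, hx, -⟩ := exists_common_frame (a := x) (d := 0) (by simp)
  let σ := Tuple.sort (fun i => -μ i)
  refine ⟨μ ∘ σ, fun i j h => ?_, e ∘ σ, he.comp_perm σ, by rw [sum_comp_perm, hx]⟩
  exact neg_le_neg_iff.1 (Tuple.monotone_sort (fun i => -μ i) h)

theorem IsJordanFrame.exists_eigenvalues_eq {e : Fin (rank V) → V} (he : IsJordanFrame e)
    (μ : Fin (rank V) → ℝ) : ∃ σ : Equiv.Perm (Fin (rank V)),
      Antitone (μ ∘ σ) ∧ eigenvalues (∑ i, μ i • e i) = μ ∘ σ := by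
  obtain ⟨h1, f, hf, h2⟩ := isEigenvalueVector_eigenvalues (∑ i, μ i • e i)
  obtain ⟨σ, hσ⟩ := he.exists_perm hf h2
  exact ⟨σ, hσ ▸ h1, hσ.symm⟩

theorem IsJordanFrame.eigenvalues_eq {e : Fin (rank V) → V} (he : IsJordanFrame e)
    {μ : Fin (rank V) → ℝ} (hμ : Antitone μ) : eigenvalues (∑ i, μ i • e i) = μ := by
  obtain ⟨σ, h1, h2⟩ := he.exists_eigenvalues_eq μ
  rw [h2]
  exact antitone_comp_unique (τ := 1) h1 hμ

theorem IsJordanFrame.eigenvalues_eq_of_frame {e f : Fin (rank V) → V} (he : IsJordanFrame e)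
    (hf : IsJordanFrame f) (μ : Fin (rank V) → ℝ) :
    eigenvalues (∑ i, μ i • e i) = eigenvalues (∑ i, μ i • f i) := by
  obtain ⟨σ, h1, h2⟩ := he.exists_eigenvalues_eq μ
  obtain ⟨τ, h3, h4⟩ := hf.exists_eigenvalues_eq μ
  rw [h2, h4]
  exact antitone_comp_unique h1 h3

theorem tr_eq_trace (x : V) : tr x = trace V x := by
  obtain ⟨-, f, hf, h⟩ := isEigenvalueVector_eigenvalues x
  conv_rhs => rw [h]
  simp [tr, trace_primitive (hf.1 _)]

theorem trace_mul_self_pos {x : V} (hx : x ≠ 0) : 0 < trace V (x * x) := by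
  obtain ⟨e, μ, -, he, h, -⟩ := exists_common_frame (a := x) (d := 0) (by simp)
  have h1 : x * x = ∑ i, (μ i) ^ 2 • e i := by
    rw [h, Finset.sum_mul]
    refine Finset.sum_congr rfl fun i _ => ?_
    rw [Finset.mul_sum, Finset.sum_eq_single i]
    · rw [mul_smul_comm, smul_mul_assoc, he.idem, smul_smul, pow_two]
    · intro j _ hj
      rw [mul_smul_comm, smul_mul_assoc, he.2.1 i j hj.symm, smul_zero, smul_zero]
    · simp
  rw [h1, map_sum]
  simp only [map_smul, trace_primitive (he.1 _), smul_eq_mul, mul_one]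
  refine (Finset.sum_nonneg fun i _ => sq_nonneg _).lt_of_ne fun h0 => hx ?_
  have h2 := (Finset.sum_eq_zero_iff_of_nonneg fun i _ => sq_nonneg (μ i)).1 h0.symm
  rw [h]
  refine Finset.sum_eq_zero fun i hi => ?_
  rw [pow_eq_zero_iff two_ne_zero |>.1 (h2 i hi), zero_smul]

end Trace
-- One-parameter groups and second-order conditions
section Flow

theorem exp_smul_mul_exp_neg_smul {E : Type*} [NormedAddCommGroup E] [NormedSpace ℝ E]
    [CompleteSpace E] (D : E →L[ℝ] E) (t : ℝ) (x : E) :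
    NormedSpace.exp (t • D) (NormedSpace.exp ((-t) • D) x) = x := by
  let _ : NormedAlgebra ℚ (E →L[ℝ] E) := NormedAlgebra.restrictScalars ℚ ℝ _
  have h : NormedSpace.exp (t • D) * NormedSpace.exp ((-t) • D) = 1 := by
    rw [← NormedSpace.exp_add_of_commute (((Commute.refl D).smul_left _).smul_right _)]
    simp
  exact DFunLike.congr_fun h x

open NormedSpace in
-- The curve `e^{-sD} m(e^{sD} x, e^{sD} y)` has derivative zero because `D` is a derivation.
theorem exp_smul_mul {E : Type*} [NormedAddCommGroup E] [NormedSpace ℝ E] [CompleteSpace E]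
    (m : E →L[ℝ] E →L[ℝ] E) (D : E →L[ℝ] E) (hD : ∀ x y, D (m x y) = m (D x) y + m x (D y))
    (t : ℝ) (x y : E) : exp (t • D) (m x y) = m (exp (t • D) x) (exp (t • D) y) := by
  have hpos : ∀ (s : ℝ) (z : E), HasDerivAt (fun s : ℝ => exp (s • D) z)
      (D (exp (s • D) z)) s := fun s z => by
    have := (hasDerivAt_exp_smul_const' (𝕂 := ℝ) D s).clm_apply (hasDerivAt_const s z)
    simpa using this
  have hneg : ∀ s : ℝ, HasDerivAt (fun s : ℝ => exp ((-s) • D)) (-(exp ((-s) • D) * D)) s :=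
    fun s => by
      have := (hasDerivAt_exp_smul_const (𝕂 := ℝ) D (-s)).scomp s (hasDerivAt_neg s)
      simpa [Function.comp_def] using this
  have hconst : ∀ s : ℝ, HasDerivAt
      (fun s : ℝ => exp ((-s) • D) (m (exp (s • D) x) (exp (s • D) y))) 0 s := fun s => by
    have h1 := ((m.hasFDerivAt.comp_hasDerivAt s (hpos s x)).clm_apply (hpos s y))
    have h2 := (hneg s).clm_apply h1
    refine h2.congr_deriv ?_
    simp [hD]
  have h := is_const_of_deriv_eq_zero (𝕜 := ℝ) (fun s => (hconst s).differentiableAt)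
    (fun s => (hconst s).deriv) t 0
  have h' := congrArg (fun z => exp (t • D) z) h
  simp only [exp_smul_mul_exp_neg_smul] at h'
  simpa using h'.symm

/-- A derivation of a finite-dimensional algebra generates a one-parameter group of automorphisms. -/
theorem exists_flow {V : Type*} [AddCommGroup V] [Module ℝ V] [FiniteDimensional ℝ V]
    (m : V →ₗ[ℝ] V →ₗ[ℝ] V) (D : V →ₗ[ℝ] V) (hD : ∀ x y, D (m x y) = m (D x) y + m x (D y)) :
    ∃ A : ℝ → V ≃ₗ[ℝ] V, (∀ x, A 0 x = x) ∧ (∀ t x y, A t (m x y) = m (A t x) (A t y)) ∧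
      ∀ (l : V →ₗ[ℝ] ℝ) (x : V) (t : ℝ), HasDerivAt (fun s => l (A s x)) (l (A t (D x))) t := by
  -- The norm is an auxiliary one pulled back from coordinates; testing against functionals `l`
  -- keeps topology out of the statement.
  let φ := (Module.finBasis ℝ V).equivFun
  let _ : NormedAddCommGroup V := NormedAddCommGroup.induced V _ φ φ.injective
  let _ : NormedSpace ℝ V := NormedSpace.induced ℝ V _ φ.toLinearMap
  have : CompleteSpace V := FiniteDimensional.complete ℝ V
  let m' : V →L[ℝ] V →L[ℝ] V :=
    LinearMap.toContinuousLinearMap (LinearMap.toContinuousLinearMap.toLinearMap ∘ₗ m)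
  let D' : V →L[ℝ] V := LinearMap.toContinuousLinearMap D
  refine ⟨fun t => LinearEquiv.ofLinearMap (NormedSpace.exp (t • D') : V →L[ℝ] V).toLinearMap
    (NormedSpace.exp ((-t) • D') : V →L[ℝ] V).toLinearMap ?_ ?_, fun x => ?_,
    fun t x y => exp_smul_mul m' D' hD t x y, fun l x t => ?_⟩
  · ext x
    exact exp_smul_mul_exp_neg_smul D' t x
  · ext x
    simpa using exp_smul_mul_exp_neg_smul D' (-t) x
  · simp
  · have h := (hasDerivAt_exp_smul_const (𝕂 := ℝ) D' t).clm_apply (hasDerivAt_const t x)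
    have h2 := (LinearMap.toContinuousLinearMap l).hasFDerivAt.comp_hasDerivAt t h
    refine h2.congr_deriv ?_
    simp [D']

/-- The second-order necessary condition at a maximum. -/
theorem second_deriv_nonpos_of_max {f f' : ℝ → ℝ} {f'' : ℝ} (hf : ∀ t, HasDerivAt f (f' t) t)
    (hf' : HasDerivAt f' f'' 0) (hmax : ∀ t, f t ≤ f 0) : f' 0 = 0 ∧ f'' ≤ 0 := by
  have h0 : f' 0 = 0 :=
    IsLocalMax.hasDerivAt_eq_zero (Filter.Eventually.of_forall hmax) (hf 0)
  refine ⟨h0, ?_⟩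
  have hd : deriv f = f' := funext fun t => (hf t).deriv
  -- A positive second derivative would make `0` a local minimum too, so `f` would be locally
  -- constant and `f''` zero.
  by_contra! h
  have hmin := isLocalMin_of_deriv_deriv_pos (f := f) (x₀ := 0) (by rwa [hd, hf'.deriv])
    (by rw [hd, h0]) (hf 0).continuousAt
  have hc : f =ᶠ[nhds 0] fun _ => f 0 := by
    filter_upwards [hmin] with t ht using le_antisymm (hmax t) ht
  have h1 : f' =ᶠ[nhds 0] fun _ => 0 := by
    rw [← hd]
    simpa using hc.deriv
  have h2 := h1.deriv_eq
  rw [hf'.deriv] at h2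
  simp at h2
  exact h.ne' h2

end Flow

/-! ### Inner derivations, automorphisms and associativity of the trace form -/

section Assoc

variable {V : Type*} [NonAssocCommRing V] [Module ℝ V] [IsScalarTower ℝ V V]
  [SMulCommClass ℝ V V] [EuclideanJordanAlgebra V]

/-- The inner derivation `[L_u, L_v]`. -/
def innerDer (u v : V) : V →ₗ[ℝ] V :=
  LinearMap.mulLeft ℝ u ∘ₗ LinearMap.mulLeft ℝ v - LinearMap.mulLeft ℝ v ∘ₗ LinearMap.mulLeft ℝ u

theorem innerDer_apply (u v x : V) : innerDer u v x = u * (v * x) - v * (u * x) := rfl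

theorem innerDer_mul (u v x y : V) :
    innerDer u v (x * y) = innerDer u v x * y + x * innerDer u v y := by
  have h1 := polarized_jordan v x y u
  have h2 := polarized_jordan u x y v
  simp only [innerDer_apply, sub_mul, mul_sub]
  simp only [mul_comm] at h1 h2 ⊢
  linear_combination (norm := module) h2 - h1

theorem IsAutomorphism.map_one {A : V ≃ₗ[ℝ] V} (hA : IsAutomorphism A) : A 1 = 1 := by
  have := hA (A.symm 1) 1
  simpa using this.symm

theorem IsAutomorphism.symm {A : V ≃ₗ[ℝ] V} (hA : IsAutomorphism A) : IsAutomorphism A.symm :=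
  fun x y => A.injective (by rw [hA]; simp)

theorem IsAutomorphism.isPrimitive {A : V ≃ₗ[ℝ] V} (hA : IsAutomorphism A) {c : V}
    (hc : IsPrimitive c) : IsPrimitive (A c) := by
  refine ⟨by simpa using hc.1, by rw [← hA, hc.2.1], ?_⟩
  rintro ⟨p, q, hp0, hq0, hp, hq, h⟩
  refine hc.2.2 ⟨A.symm p, A.symm q, by simpa, by simpa, by rw [← hA.symm, hp],
    by rw [← hA.symm, hq], ?_⟩
  rw [← map_add, ← h, LinearEquiv.symm_apply_apply]

theorem IsAutomorphism.isJordanFrame {A : V ≃ₗ[ℝ] V} (hA : IsAutomorphism A)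
    {e : Fin (rank V) → V} (he : IsJordanFrame e) : IsJordanFrame (A ∘ e) :=
  ⟨fun i => hA.isPrimitive (he.1 i), fun i j h => by
    simp only [Function.comp]
    rw [← hA, he.2.1 i j h, map_zero], by
    simp only [Function.comp]
    rw [← map_sum, he.2.2, hA.map_one]⟩

theorem IsAutomorphism.eigenvalues_eq {A : V ≃ₗ[ℝ] V} (hA : IsAutomorphism A) (x : V) :
    eigenvalues (A x) = eigenvalues x := by
  obtain ⟨h1, e, he, h2⟩ := isEigenvalueVector_eigenvalues x
  have h3 : A x = ∑ i, eigenvalues x i • (A ∘ e) i := by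
    conv_lhs => rw [h2]
    simp
  conv_lhs => rw [h3]
  exact (hA.isJordanFrame he).eigenvalues_eq h1

theorem IsAutomorphism.trace_eq {A : V ≃ₗ[ℝ] V} (hA : IsAutomorphism A) (x : V) :
    trace V (A x) = trace V x := by
  rw [← tr_eq_trace, ← tr_eq_trace, tr, tr, hA.eigenvalues_eq]

theorem exists_automorphism_flow (u v : V) :
    ∃ A : ℝ → V ≃ₗ[ℝ] V, (∀ x, A 0 x = x) ∧ (∀ t, IsAutomorphism (A t)) ∧
      ∀ (l : V →ₗ[ℝ] ℝ) (x : V) (t : ℝ),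
        HasDerivAt (fun s => l (A s x)) (l (A t (innerDer u v x))) t :=
  exists_flow (LinearMap.mul ℝ V) (innerDer u v) fun x y => innerDer_mul u v x y

/-- Automorphisms preserve eigenvalues, hence the trace; differentiating along the flow shows that
the trace vanishes on `[L_u, L_v] x`. -/
theorem trace_mul_left_comm (u v x : V) : trace V (u * (v * x)) = trace V (v * (u * x)) := by
  obtain ⟨A, h0, hA, hderiv⟩ := exists_automorphism_flow u v
  have h := hderiv (trace V) x 0
  simp only [(hA _).trace_eq, innerDer_apply] at h
  have h' := h.unique (hasDerivAt_const 0 _)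
  rw [map_sub] at h'
  linarith

end Assoc
-- Commutation from maximality, and the ordering of coefficients
section Commutation

variable {V : Type*} [NonAssocCommRing V] [Module ℝ V] [IsScalarTower ℝ V V]
  [SMulCommClass ℝ V V] [EuclideanJordanAlgebra V]

theorem trace_mul_assoc (x y z : V) : trace V ((x * y) * z) = trace V (x * (y * z)) := by
  rw [mul_comm (x * y), trace_mul_left_comm, mul_comm z]

theorem operatorCommute_of_max {a d : V}
    (h : ∀ A : V ≃ₗ[ℝ] V, IsAutomorphism A → trace V (d * A a) ≤ trace V (d * a)) :
    OperatorCommute d a ∧ ∀ u v, trace V (d * innerDer u v (innerDer u v a)) ≤ 0 := by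
  have key : ∀ u v, trace V (d * innerDer u v a) = 0 ∧
      trace V (d * innerDer u v (innerDer u v a)) ≤ 0 := by
    intro u v
    obtain ⟨A, h0, hA, hderiv⟩ := exists_automorphism_flow u v
    let l : V →ₗ[ℝ] ℝ := trace V ∘ₗ LinearMap.mulLeft ℝ d
    have h1 := second_deriv_nonpos_of_max (f := fun t => l (A t a))
      (f' := fun t => l (A t (innerDer u v a))) (hderiv l a) (hderiv l (innerDer u v a) 0)
      (fun t => by simpa [l, h0] using h (A t) (hA t))
    simpa [l, h0] using h1
  refine ⟨fun u => ?_, fun u v => (key u v).2⟩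
  by_contra hne
  refine (trace_mul_self_pos (sub_ne_zero.2 hne)).ne' ?_
  -- With `v` the commutator `[L_d, L_a] u` itself, the first-order condition becomes `trace (v * v)
  -- = 0`.
  obtain ⟨v, hv⟩ : ∃ v, v = d * (a * u) - a * (d * u) := ⟨_, rfl⟩
  rw [← hv]
  have h1 := (key u v).1
  rw [innerDer_apply, mul_sub, map_sub] at h1
  nth_rw 1 [hv]
  rw [sub_mul, map_sub]
  have h2 : trace V (d * (u * (v * a))) = trace V (a * (d * u) * v) := by
    rw [← trace_mul_assoc d u, mul_comm v a, ← trace_mul_assoc, mul_comm (d * u) a]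
  have h3 : trace V (d * (v * (u * a))) = trace V (d * (a * u) * v) := by
    rw [mul_comm v, ← trace_mul_assoc, mul_comm u a]
  linarith

theorem IsJordanFrame.mul_sum_smul {e : Fin (rank V) → V} (he : IsJordanFrame e)
    (μ : Fin (rank V) → ℝ) (i) : (∑ k, μ k • e k) * e i = μ i • e i := by
  rw [Finset.sum_mul, Finset.sum_eq_single i]
  · rw [smul_mul_assoc, he.idem]
  · intro j _ hj
    rw [smul_mul_assoc, he.2.1 j i hj, smul_zero]
  · simp

theorem IsJordanFrame.linearIndependent {e : Fin (rank V) → V} (he : IsJordanFrame e) :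
    LinearIndependent ℝ e := by
  rw [Fintype.linearIndependent_iff]
  intro g hg i
  have h := he.mul_sum_smul g i
  rw [hg, zero_mul] at h
  exact (smul_eq_zero.1 h.symm).resolve_right (he.1 i).1

theorem stronglyOperatorCommute_of_frame {e : Fin (rank V) → V} (he : IsJordanFrame e)
    {μ ν : Fin (rank V) → ℝ} (h : ∀ i j, i ≠ j → 0 ≤ (μ i - μ j) * (ν i - ν j)) :
    StronglyOperatorCommute (∑ i, ν i • e i) (∑ i, μ i • e i) := by
  -- Where `μ` has ties, the hypothesis says nothing about `ν`, so ties are broken by `ν`; the signs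
  -- make the order decreasing.
  let key : Fin (rank V) → ℝ ×ₗ ℝ := fun i => toLex (-μ i, -ν i)
  let σ := Tuple.sort key
  have hkey : ∀ i j, i ≤ j → -μ (σ i) < -μ (σ j) ∨
      -μ (σ i) = -μ (σ j) ∧ -ν (σ i) ≤ -ν (σ j) := fun i j hij => by
    have := Tuple.monotone_sort key hij
    simpa only [Function.comp, key, Prod.Lex.toLex_le_toLex] using this
  have hμ : Antitone (μ ∘ σ) := fun i j hij => by
    simp only [Function.comp]
    rcases hkey i j hij with h1 | h1 <;> linarith
  have hν : Antitone (ν ∘ σ) := fun i j hij => by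
    simp only [Function.comp]
    rcases hkey i j hij with h1 | h1
    · have h2 := h (σ i) (σ j) (fun h3 => by rw [h3] at h1; exact lt_irrefl _ h1)
      by_contra! h3
      nlinarith
    · linarith
  have h1 := (he.comp_perm σ).eigenvalues_eq hμ
  have h2 := (he.comp_perm σ).eigenvalues_eq hν
  rw [sum_comp_perm] at h1 h2
  exact ⟨e ∘ σ, he.comp_perm σ, by rw [h2, sum_comp_perm], by rw [h1, sum_comp_perm]⟩

theorem sum_smul_swap {ι : Type*} [Fintype ι] [DecidableEq ι] (μ : ι → ℝ) (e : ι → V) {i j : ι}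
    (hij : i ≠ j) : ∑ k, μ k • e (Equiv.swap i j k) =
      ∑ k, μ k • e k - (μ i - μ j) • (e i - e j) := by
  have h : ∀ k, μ k • e (Equiv.swap i j k) = μ k • e k + (if k = i then μ i • (e j - e i) else 0)
      + (if k = j then μ j • (e i - e j) else 0) := by
    intro k
    rw [Equiv.swap_apply_def]
    split_ifs with h1 h2 h2
    · exact absurd (h1.symm.trans h2) hij
    · subst h1; module
    · subst h2; module
    · module
  simp only [h, Finset.sum_add_distrib, Finset.sum_ite_eq', Finset.mem_univ, if_true]
  module

/-- Swapping lowers the pairing with `∑ νₖ eₖ` by exactly `(μᵢ - μⱼ)(νᵢ - νⱼ)`. -/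
theorem IsJordanFrame.nonneg_of_swap {e : Fin (rank V) → V} (he : IsJordanFrame e)
    {μ ν : Fin (rank V) → ℝ} {i j : Fin (rank V)} (hij : i ≠ j)
    (h : trace V ((∑ k, ν k • e k) * ∑ k, μ k • e (Equiv.swap i j k)) ≤
      trace V ((∑ k, ν k • e k) * ∑ k, μ k • e k)) : 0 ≤ (μ i - μ j) * (ν i - ν j) := by
  rw [sum_smul_swap μ e hij, mul_sub, mul_smul_comm, mul_sub, he.mul_sum_smul, he.mul_sum_smul] at h
  simp only [map_sub, map_smul, smul_eq_mul, trace_primitive (he.1 _), mul_one] at h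
  linarith

/-- By associativity `eᵢ x` lies in the Peirce one space of `eᵢ`, which is `ℝ eᵢ`; so the frame is a
basis, and permuting it respects the product. -/
theorem IsJordanFrame.exists_swap_automorphism (hV : ∀ x y z : V, x * (y * z) = (x * y) * z)
    {e : Fin (rank V) → V} (he : IsJordanFrame e) (σ : Equiv.Perm (Fin (rank V))) :
    ∃ A : V ≃ₗ[ℝ] V, IsAutomorphism A ∧ ∀ k, A (e k) = e (σ k) := by
  have hspan : ⊤ ≤ Submodule.span ℝ (Set.range e) := fun x _ => by
    have : x = ∑ i, e i * x := by rw [← Finset.sum_mul, he.2.2, one_mul]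
    rw [this]
    refine sum_mem fun i _ => ?_
    obtain ⟨r, hr⟩ := (he.1 i).eq_smul (x := e i * x) (by rw [hV, he.idem])
    rw [hr]
    exact Submodule.smul_mem _ _ (Submodule.subset_span ⟨i, rfl⟩)
  let b := Module.Basis.mk he.linearIndependent hspan
  have hb : ∀ k, b k = e k := fun k => Module.Basis.mk_apply _ _ k
  have hA : ∀ k, (b.equiv b σ) (e k) = e (σ k) := fun k => by
    rw [← hb, Module.Basis.equiv_apply, hb]
  refine ⟨b.equiv b σ, fun x y => ?_, hA⟩
  have h : (LinearMap.mul ℝ V).compr₂ (b.equiv b σ).toLinearMap =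
      (LinearMap.mul ℝ V).compl₁₂ (b.equiv b σ).toLinearMap (b.equiv b σ).toLinearMap := by
    refine LinearMap.ext_basis b b fun i j => ?_
    simp only [LinearMap.compr₂_apply, LinearMap.compl₁₂_apply, LinearMap.mul_apply', hb,
      LinearEquiv.coe_coe, hA]
    by_cases hij : i = j
    · rw [hij, he.idem, he.idem, hA]
    · rw [he.2.1 i j hij, he.2.1 _ _ (fun h => hij (σ.injective h)), map_zero]
  exact LinearMap.congr_fun (LinearMap.congr_fun h x) y

/-- The Peirce space of `i`, `j` relative to a Jordan frame is nonzero. -/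
def Linked (e : Fin (rank V) → V) (i j : Fin (rank V)) : Prop :=
  ∃ w : V, w ≠ 0 ∧ e i * w = (1 / 2 : ℝ) • w ∧ e j * w = (1 / 2 : ℝ) • w

theorem IsJordanFrame.pair_idem {e : Fin (rank V) → V} (he : IsJordanFrame e)
    {i j : Fin (rank V)} (hij : i ≠ j) : (e i + e j) * (e i + e j) = e i + e j := by
  rw [add_mul, mul_add, mul_add, he.idem, he.idem, he.2.1 i j hij, he.2.1 j i hij.symm]
  abel

theorem pair_mul {e : Fin (rank V) → V} {i j : Fin (rank V)} {w : V}
    (hi : e i * w = (1 / 2 : ℝ) • w) (hj : e j * w = (1 / 2 : ℝ) • w) :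
    (e i + e j) * w = w := by
  rw [add_mul, hi, hj]; module

/-- `w` lies in the one space and `eₖ` in the zero space of `eᵢ + eⱼ`. -/
theorem IsJordanFrame.mul_eq_zero {e : Fin (rank V) → V} (he : IsJordanFrame e)
    {i j k : Fin (rank V)} (hij : i ≠ j) (hki : k ≠ i) (hkj : k ≠ j) {w : V}
    (hi : e i * w = (1 / 2 : ℝ) • w) (hj : e j * w = (1 / 2 : ℝ) • w) : e k * w = 0 := by
  rw [mul_comm]
  refine peirce_one_mul_zero (he.pair_idem hij) (pair_mul hi hj) ?_
  rw [add_mul, he.2.1 i k hki.symm, he.2.1 j k hkj.symm, add_zero]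

theorem IsJordanFrame.sum_mul_half {e : Fin (rank V) → V} (he : IsJordanFrame e)
    {i j : Fin (rank V)} (hij : i ≠ j) {w : V} (hi : e i * w = (1 / 2 : ℝ) • w)
    (hj : e j * w = (1 / 2 : ℝ) • w) (μ : Fin (rank V) → ℝ) :
    (∑ k, μ k • e k) * w = ((μ i + μ j) / 2) • w := by
  rw [Finset.sum_mul, ← Finset.sum_subset (Finset.subset_univ {i, j}), Finset.sum_pair hij,
    smul_mul_assoc, smul_mul_assoc, hi, hj]
  · module
  · intro k _ hk
    simp only [Finset.mem_insert, Finset.mem_singleton, not_or] at hk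
    rw [smul_mul_assoc, he.mul_eq_zero hij hk.1 hk.2 hi hj, smul_zero]

theorem trace_idempotent_mul_sq {e : Fin (rank V) → V} {i : Fin (rank V)} {w : V}
    (hi : e i * w = (1 / 2 : ℝ) • w) : trace V (e i * (w * w)) = 1 / 2 * trace V (w * w) := by
  rw [trace_mul_left_comm, hi, mul_smul_comm, map_smul, smul_eq_mul]

/-- For `D = [L_{eᵢ}, L_w]`, `D a = (μⱼ - μᵢ)/4 · w` and `tr(d · D w) = (νᵢ - νⱼ)/4 · tr(w²)`. Hence
`tr(d · D² a)` is `-(μᵢ - μⱼ)(νᵢ - νⱼ)/16` times the positive number `tr(w²)`. -/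
theorem IsJordanFrame.nonneg_of_linked {e : Fin (rank V) → V} (he : IsJordanFrame e)
    {μ ν : Fin (rank V) → ℝ} {i j : Fin (rank V)} (hij : i ≠ j) (hl : Linked e i j)
    (h : ∀ u v, trace V ((∑ k, ν k • e k) * innerDer u v (innerDer u v (∑ k, μ k • e k))) ≤ 0) :
    0 ≤ (μ i - μ j) * (ν i - ν j) := by
  obtain ⟨w, hw, hi, hj⟩ := hl
  obtain ⟨a, ha⟩ : ∃ a, a = ∑ k, μ k • e k := ⟨_, rfl⟩
  obtain ⟨d, hd⟩ : ∃ d, d = ∑ k, ν k • e k := ⟨_, rfl⟩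
  have h1 := h (e i) w
  rw [← ha, ← hd] at h1
  have hae : a * e i = μ i • e i := ha ▸ he.mul_sum_smul μ i
  have hde : d * e i = ν i • e i := hd ▸ he.mul_sum_smul ν i
  have haw : a * w = ((μ i + μ j) / 2) • w := ha ▸ he.sum_mul_half hij hi hj μ
  have hdw : d * w = ((ν i + ν j) / 2) • w := hd ▸ he.sum_mul_half hij hi hj ν
  have hDa : innerDer (e i) w a = ((μ j - μ i) / 4) • w := by
    rw [innerDer_apply, mul_comm w a, haw, mul_comm (e i) a, hae, mul_smul_comm, mul_smul_comm,
      mul_comm w, hi]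
    module
  have hdD : trace V (d * innerDer (e i) w w) = (ν i - ν j) / 4 * trace V (w * w) := by
    rw [innerDer_apply, hi, mul_sub, map_sub, ← trace_mul_assoc, hde, smul_mul_assoc, map_smul,
      trace_idempotent_mul_sq hi, mul_smul_comm, mul_smul_comm, map_smul, ← trace_mul_assoc,
      hdw, smul_mul_assoc, map_smul]
    simp only [smul_eq_mul]
    ring
  rw [hDa, map_smul, mul_smul_comm, map_smul, hdD, smul_eq_mul] at h1
  have := trace_mul_self_pos hw
  by_contra! h2
  nlinarith

theorem IsJordanFrame.mul_self_eq {e : Fin (rank V) → V} (he : IsJordanFrame e)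
    {i : Fin (rank V)} {w : V} (hi : e i * w = (1 / 2 : ℝ) • w) :
    e i * (w * w) = (1 / 2 * trace V (w * w)) • e i := by
  obtain ⟨r, hr⟩ := (he.1 i).eq_smul (peirce_half_mul_half (he.idem i) hi hi)
  have h := trace_idempotent_mul_sq hi
  rw [hr, map_smul, trace_primitive (he.1 i), smul_eq_mul, mul_one] at h
  rw [hr, h]

theorem IsJordanFrame.linked_trans {e : Fin (rank V) → V} (he : IsJordanFrame e)
    {i j k : Fin (rank V)} (hij : i ≠ j) (hjk : j ≠ k) (hik : i ≠ k) (h1 : Linked e i j)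
    (h2 : Linked e j k) : Linked e i k := by
  obtain ⟨x, hx, hxi, hxj⟩ := h1
  obtain ⟨y, hy, hyj, hyk⟩ := h2
  have hxk := he.mul_eq_zero hij hik.symm hjk.symm hxi hxj
  have hyi := he.mul_eq_zero hjk hij hik hyj hyk
  refine ⟨x * y, fun h0 => ?_, ?_, ?_⟩
  · have hp := peirce_mul (he.pair_idem hij) (i := 1) (j := 1) (u := x) (v := x) (by norm_num)
      (by rw [pair_mul hxi hxj, one_smul]) (by rw [pair_mul hxi hxj, one_smul])
    rw [one_smul, add_mul, he.mul_self_eq hxi, he.mul_self_eq hxj] at hp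
    have h3 : x * x * y = (1 / 4 * trace V (x * x)) • y := by
      have h := congrArg (· * y) hp
      simp only [add_mul, smul_mul_assoc, hyi, hyj] at h
      rw [← h]
      module
    -- If `xy = 0`, only the term `y * ((e i * x) * x)`, half of `x² y`, survives in this instance;
    -- but `x² y` is a positive multiple of `y`.
    have h4 := polarized_jordan x y (e i) x
    rw [mul_comm y (e i), hyi, hxi, mul_comm y x, h0, smul_mul_assoc, mul_smul_comm,
      mul_comm y, h3] at h4
    simp only [zero_mul, mul_zero, zero_add, add_zero, smul_smul] at h4
    have h5 := trace_mul_self_pos hx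
    have h6 := (smul_eq_zero.1 h4).resolve_right hy
    linarith
  · rw [mul_comm x]
    exact peirce_mul (he.idem i) (i := 0) (by norm_num) (by rw [hyi, zero_smul]) hxi
  · exact peirce_mul (he.idem k) (i := 0) (by norm_num) (by rw [hxk, zero_smul]) hyk

theorem IsJordanFrame.linked_of_isSimple (hV : IsSimple V) {e : Fin (rank V) → V}
    (he : IsJordanFrame e) {i j : Fin (rank V)} (hij : i ≠ j) : Linked e i j := by
  classical
  by_contra hl
  -- By transitivity nothing in `K` is linked to its complement. So `p = ∑_{k ∈ K} eₖ` has no half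
  -- space, and its one and zero spaces are complementary ideals, nonzero because they contain `e i`
  -- and `e j`.
  let K : Finset (Fin (rank V)) := Finset.univ.filter fun k => k = i ∨ Linked e i k
  have hiK : i ∈ K := by simp [K]
  have hjK : j ∉ K := by simp [K, hl, hij.symm]
  obtain ⟨p, hp⟩ : ∃ p, p = ∑ k ∈ K, e k := ⟨_, rfl⟩
  have hpe : ∀ k ∈ K, p * e k = e k := fun k hk => by
    rw [hp, Finset.sum_mul, Finset.sum_eq_single_of_mem k hk, he.idem]
    exact fun l _ hl => he.2.1 l k hl
  have hpe' : ∀ k ∉ K, p * e k = 0 := fun k hk => by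
    rw [hp, Finset.sum_mul]
    exact Finset.sum_eq_zero fun l hl => he.2.1 l k (fun h => hk (h ▸ hl))
  have hpp : p * p = p := by
    have h : p * p = p * ∑ k ∈ K, e k := congrArg (p * ·) hp
    rw [h, Finset.mul_sum, Finset.sum_congr rfl hpe, hp]
  have hq : 1 - p = ∑ l ∈ Kᶜ, e l := by
    rw [hp, ← he.2.2, ← Finset.sum_add_sum_compl K, add_sub_cancel_left]
  have hkl : ∀ k ∈ K, ∀ l ∈ Kᶜ, ∀ x, e k * (e l * x) = 0 := by
    intro k hk l hl x
    rw [Finset.mem_compl] at hl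
    have hne : k ≠ l := fun h => hl (h ▸ hk)
    by_contra hw
    have hkl : Linked e k l := by
      refine ⟨_, hw, orthogonal_mul_half (he.idem k) (he.2.1 k l hne) x, ?_⟩
      rw [orthogonal_commute (he.idem k) (he.2.1 k l hne)]
      exact orthogonal_mul_half (he.idem l) (he.2.1 l k hne.symm) x
    refine hl ?_
    simp only [K, Finset.mem_filter, Finset.mem_univ, true_and] at hk ⊢
    rcases hk with rfl | hk
    · exact Or.inr hkl
    · by_cases hki : k = i
      · subst hki; exact Or.inr hkl
      · exact Or.inr (he.linked_trans (Ne.symm hki) hne (fun h => hl (h ▸ hiK)) hk hkl)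
  have heven : ∀ x, p * (p * x) = p * x := by
    intro x
    have h : p * ((1 - p) * x) = 0 := by
      rw [hq, hp, Finset.sum_mul, Finset.sum_mul]
      refine Finset.sum_eq_zero fun k hk => ?_
      rw [Finset.mul_sum]
      exact Finset.sum_eq_zero fun l hl => hkl k hk l hl x
    rw [sub_mul, one_mul, mul_sub] at h
    exact (sub_eq_zero.1 h).symm
  have hcomm : ∀ x y, p * (y * x) = y * (p * x) := fun x y => peirce_commute hpp (heven y) x
  let L := LinearMap.mulLeft ℝ p
  have hI : ∀ x, x ∈ LinearMap.ker (L - LinearMap.id) ↔ p * x = x := fun x => by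
    simp [L, sub_eq_zero]
  have hJ : ∀ x, x ∈ LinearMap.ker L ↔ p * x = 0 := fun x => by simp [L]
  rcases hV.2 (LinearMap.ker (L - LinearMap.id)) (LinearMap.ker L)
    (fun x hx y => by rw [hI] at *; rw [hcomm, hx])
    (fun x hx y => by rw [hJ] at *; rw [hcomm, hx, mul_zero])
    ⟨Submodule.disjoint_def.2 fun x h1 h2 => by rw [hI] at h1; rw [hJ] at h2; rw [← h1, h2],
      codisjoint_iff.2 (eq_top_iff.2 fun x _ => Submodule.mem_sup.2
        ⟨p * x, (hI _).2 (heven x), x - p * x, (hJ _).2 (by rw [mul_sub, heven, sub_self]),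
          by abel⟩)⟩ with h | h
  · have := (hI _).2 (hpe i hiK)
    rw [h, Submodule.mem_bot] at this
    exact (he.1 i).1 this
  · have := (hJ _).2 (hpe' j hjK)
    rw [h, Submodule.mem_bot] at this
    exact (he.1 j).1 this

theorem trace_le_of_mem_subdifferential {F : V → WithTop ℝ} {a d x : V}
    (hd : d ∈ subdifferential F a) (hx : F x = F a) : trace V (d * x) ≤ trace V (d * a) := by
  obtain ⟨h1, h2⟩ := hd
  have h3 := h2 x
  obtain ⟨r, hr⟩ := WithTop.ne_top_iff_exists.1 h1
  rw [hx, ← hr, ← WithTop.coe_add, WithTop.coe_le_coe, ip, tr_eq_trace, mul_sub, map_sub] at h3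
  linarith

theorem IsSpectral.isWeaklySpectral {F : V → WithTop ℝ} (hF : IsSpectral F) :
    IsWeaklySpectral F := by
  obtain ⟨f, -, hf⟩ := hF
  intro A hA x
  rw [hf, hf, hA.eigenvalues_eq]

theorem IsWeaklySpectral.operatorCommute {F : V → WithTop ℝ} (hF : IsWeaklySpectral F) {a d : V}
    (hd : d ∈ subdifferential F a) : OperatorCommute d a ∧
      ∀ u v, trace V (d * innerDer u v (innerDer u v a)) ≤ 0 :=
  operatorCommute_of_max fun A hA => trace_le_of_mem_subdifferential hd (hF A hA a)

theorem OperatorCommute.exists_common_frame {a d : V} (h : OperatorCommute d a) :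
    ∃ (e : Fin (rank V) → V) (μ ν : Fin (rank V) → ℝ), IsJordanFrame e ∧
      a = ∑ i, μ i • e i ∧ d = ∑ i, ν i • e i :=
  -- Commutation is needed only at the vector `a`.
  EJA.exists_common_frame (by rw [mul_comm a d, ← h a, mul_comm])

end Commutation

end EJA

theorem mainTheorem3 {V : Type*} [NonAssocCommRing V] [Module ℝ V]
    [IsScalarTower ℝ V V] [SMulCommClass ℝ V V] [EJA.EuclideanJordanAlgebra V]
    (F : V → WithTop ℝ) (a d : V) (hd : d ∈ EJA.subdifferential F a) :
    (EJA.IsSpectral F → EJA.StronglyOperatorCommute d a) ∧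
      (EJA.IsWeaklySpectral F → EJA.OperatorCommute d a) ∧
      (EJA.IsEssentiallySimple V → EJA.IsWeaklySpectral F →
        EJA.StronglyOperatorCommute d a) := by
  refine ⟨fun hF => ?_, fun hF => (hF.operatorCommute hd).1, fun hV hF => ?_⟩
  · obtain ⟨e, μ, ν, he, rfl, rfl⟩ := (hF.isWeaklySpectral.operatorCommute hd).1.exists_common_frame
    obtain ⟨f, -, hf⟩ := hF
    refine EJA.stronglyOperatorCommute_of_frame he fun i j hij => he.nonneg_of_swap hij
      (EJA.trace_le_of_mem_subdifferential hd ?_)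
    rw [hf, hf]
    -- Eigenvalues depend only on the coefficients, not on the frame carrying them.
    exact congrArg f ((he.comp_perm (Equiv.swap i j)).eigenvalues_eq_of_frame he μ)
  · obtain ⟨hcomm, hsecond⟩ := hF.operatorCommute hd
    obtain ⟨e, μ, ν, he, rfl, rfl⟩ := hcomm.exists_common_frame
    refine EJA.stronglyOperatorCommute_of_frame he fun i j hij => ?_
    rcases hV with hV | ⟨m, φ, hφ⟩
    · exact he.nonneg_of_linked hij (he.linked_of_isSimple hV hij) hsecond
    · have hassoc : ∀ x y z : V, x * (y * z) = (x * y) * z := fun x y z =>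
        φ.injective (by simp only [hφ, mul_assoc])
      obtain ⟨A, hA, hAe⟩ := he.exists_swap_automorphism hassoc (Equiv.swap i j)
      refine he.nonneg_of_swap hij (EJA.trace_le_of_mem_subdifferential hd ?_)
      rw [← hF A hA (∑ k, μ k • e k), map_sum]
      simp only [map_smul, hAe]
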